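/- Let $n\ge 1$ and let $K$ be a tempered distribution on $\mathbb R^n$ whose Fourier transform is a bounded function, and which coincides on $\mathbb R^n\setminus\{0\}$ with a complex-valued function, also denoted by $K$. Suppose that there are constants $c<\infty$, $c'>0$ and a unit vector $u_0\in\mathbb R^n$ such that $$|K(x)|\le \frac{c}{|x|^n}\quad (x\ne 0),\qquad |K(x)-K(x-y)|\le \frac{c\,|y|}{|x|^{n+1}}\quad\Big(|y|<\frac{|x|}{2}\Big),$$ $$|K(tu_0)|\ge \frac{c'}{|tu_0|^n}\quad (t\in\mathbb R,\ t\neq 0).$$ Let $p:\mathbb R^n\to[1,\infty)$ be a measurable function with $p_-=\operatorname{ess\,inf}p>1$ and $p_+=\operatorname{ess\,sup}p<\infty$, and let $L^{p(\cdot)}(\mathbb R^n)$ be the space of measurable $f:\mathbb R^n\to\mathbb C$ such that $\int_{\mathbb R^n}|f(x)/\lambda|^{p(x)}dx<\infty$ for some $\lambda>0$. Then for every $f\in L^{p(\cdot)}(\mathbb R^n)$ the convolution $Tf=f*K$ is a well-defined locally integrable function: up to null sets there is exactly one locally integrable $Tf$ such that $$\int_{\mathbb R^n} Tf(x)\varphi(x)\,dx=\int_{\mathbb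 R^n} f(y)\,\langle K,\varphi(\cdot+y)\rangle\,dy\qquad(\varphi\in C_c^\infty(\mathbb R^n)),$$ where the integral on the right converges absolutely. Moreover, there is a constant $C<\infty$ such that $$\int_{\mathbb R^n}|Tf(x)|^{p(x)}dx\le C\int_{\mathbb R^n}|f(x)|^{p(x)}dx\qquad\text{for all } f\in L^{p(\cdot)}(\mathbb R^n)$$ if and only if $p$ is constant almost everywhere. -/

import Mathlib

open MeasureTheory
open scoped SchwartzMap FourierTransform ENNReal NNReal

noncomputable section

namespace VarLp

/-- Euclidean space `ℝⁿ`, with the Euclidean norm. -/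
abbrev Rn (n : ℕ) : Type := EuclideanSpace ℝ (Fin n)

/-- The modular `∫ |f(x)|^{p(x)} dx`, with values in `[0, ∞]`. -/
def modular {n : ℕ} (p : Rn n → ℝ) (f : Rn n → ℂ) : ℝ≥0∞ :=
  ∫⁻ x, ‖f x‖ₑ ^ p x

/-- `f ∈ L^{p(·)}(ℝⁿ)`: `f` is measurable and `∫ |f(x)/r|^{p(x)} dx < ∞` for some `r > 0`. -/
def MemVarLp {n : ℕ} (p : Rn n → ℝ) (f : Rn n → ℂ) : Prop :=
  AEStronglyMeasurable f volume ∧ ∃ r : ℝ, 0 < r ∧ modular p (fun x => f x / (r : ℂ)) < ∞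

/-- `p₋`, the essential infimum of the non-negative function `p`. -/
def pMinus {n : ℕ} (p : Rn n → ℝ) : ℝ≥0∞ :=
  essInf (fun x => ENNReal.ofReal (p x)) volume

/-- `p₊`, the essential supremum of the non-negative function `p`. -/
def pPlus {n : ℕ} (p : Rn n → ℝ) : ℝ≥0∞ :=
  essSup (fun x => ENNReal.ofReal (p x)) volume

/-- The tempered distribution `K` on `ℝⁿ` is a standard convolution Calderón–Zygmund kernel, given
away from the origin by the function `k`. The value `k 0` plays no role. -/
structure IsCZKernel {n : ℕ} (K : 𝓢'(Rn n, ℂ)) (k : Rn n → ℂ) : Prop where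
  /-- The Fourier transform of `K` is a bounded function. -/
  fourier_bounded : ∃ m : Lp ℂ ∞ (volume : Measure (Rn n)), 𝓕 K = Lp.toTemperedDistribution m
  /-- `K` coincides with the function `k` on `ℝⁿ ∖ {0}`. -/
  eq_off_zero : ∀ φ : 𝓢(Rn n, ℂ), HasCompactSupport φ → (0 : Rn n) ∉ tsupport φ →
    K φ = ∫ x, k x * φ x
  /-- The size condition `|k(x)| ≤ c / |x|ⁿ`. -/
  size : ∃ c : ℝ, ∀ x : Rn n, x ≠ 0 → ‖k x‖ ≤ c / ‖x‖ ^ n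
  /-- The smoothness condition `|k(x) - k(x - y)| ≤ c |y| / |x|ⁿ⁺¹` for `|y| < |x| / 2`. -/
  smooth : ∃ c : ℝ, ∀ x y : Rn n, ‖y‖ < ‖x‖ / 2 → ‖k x - k (x - y)‖ ≤ c * ‖y‖ / ‖x‖ ^ (n + 1)

/-- Nondegeneracy: for some unit vector `u` and some `c' > 0`, `|k(tu)| ≥ c' / |tu|ⁿ` for all real
`t ≠ 0` (of both signs). -/
def Nondegenerate {n : ℕ} (k : Rn n → ℂ) : Prop :=
  ∃ u : Rn n, ‖u‖ = 1 ∧ ∃ c' : ℝ, 0 < c' ∧ ∀ t : ℝ, t ≠ 0 → c' / ‖t • u‖ ^ n ≤ ‖k (t • u)‖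

/-- The function `y ↦ ⟨K, φ(· + y)⟩ = "∫ K(x - y) φ(x) dx"`. -/
def transposeConv {n : ℕ} (K : 𝓢'(Rn n, ℂ)) (φ : 𝓢(Rn n, ℂ)) (y : Rn n) : ℂ :=
  K (φ.compSubConstCLM ℂ (-y))

/-- `g = f * K` in the sense of distributions: `g` is locally integrable and
`∫ g(x) φ(x) dx = ∫ f(y) ⟨K, φ(· + y)⟩ dy` for each test function `φ ∈ C_c^∞(ℝⁿ)`, the integral on
the right being absolutely convergent. -/
def IsConvolution {n : ℕ} (K : 𝓢'(Rn n, ℂ)) (f g : Rn n → ℂ) : Prop :=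
  LocallyIntegrable g volume ∧
    ∀ φ : 𝓢(Rn n, ℂ), HasCompactSupport φ →
      Integrable (fun y => f y * transposeConv K φ y) volume ∧
        ∫ x, g x * φ x = ∫ y, f y * transposeConv K φ y

end VarLp

end

namespace VarLp

open Set Filter Metric Topology

variable {n : ℕ}

theorem integrable_mul_of_locallyIntegrable {g : Rn n → ℂ} (hg : LocallyIntegrable g volume)
    {φ : Rn n → ℂ} (hφ : Continuous φ) (hc : HasCompactSupport φ) :
    Integrable (fun x => g x * φ x) volume := by
  have := hg.integrable_smul_left_of_hasCompactSupport hφ hc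
  simpa [smul_eq_mul, mul_comm] using this

theorem integrable_mul_of_locallyIntegrableOn {g : Rn n → ℂ} {U : Set (Rn n)}
    (hg : LocallyIntegrableOn g U volume)
    {φ : Rn n → ℂ} (hφ : Continuous φ) (hc : HasCompactSupport φ) (hU : tsupport φ ⊆ U) :
    Integrable (fun x => g x * φ x) volume := by
  have h1 : IntegrableOn g (tsupport φ) volume := hg.integrableOn_compact_subset hU hc
  have h2 : IntegrableOn (fun x => g x * φ x) (tsupport φ) volume :=
    h1.mul_continuousOn hφ.continuousOn hc
  rw [← integrableOn_iff_integrable_of_support_subset (s := tsupport φ)]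
  · exact h2
  · intro x hx
    exact subset_tsupport _ (right_ne_zero_of_mul hx)

theorem ae_eq_on_of_forall_integral_mul_eq {U : Set (Rn n)} (hU : IsOpen U) {g h : Rn n → ℂ}
    (hg : LocallyIntegrableOn g U volume) (hh : LocallyIntegrableOn h U volume)
    (H : ∀ φ : 𝓢(Rn n, ℂ), HasCompactSupport φ → tsupport φ ⊆ U →
      ∫ x, g x * φ x = ∫ x, h x * φ x) :
    ∀ᵐ x ∂(volume : Measure (Rn n)), x ∈ U → g x = h x := by
  have key := hU.ae_eq_zero_of_integral_contDiff_smul_eq_zero (hg.sub hh) (μ := volume) ?_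
  · filter_upwards [key] with x hx hxU
    exact sub_eq_zero.1 (hx hxU)
  intro θ hθ hc hs
  have hc' : HasCompactSupport (fun x => (θ x : ℂ)) := hc.comp_left (g := ((↑) : ℝ → ℂ)) rfl
  have hθ' : ContDiff ℝ ((⊤ : ℕ∞) : WithTop ℕ∞) (fun x => (θ x : ℂ)) := Complex.ofRealCLM.contDiff.comp hθ
  have hs' : tsupport (fun x => (θ x : ℂ)) ⊆ U := by
    refine subset_trans (closure_mono ?_) hs
    intro x hx
    simpa using hx
  have := H (hc'.toSchwartzMap hθ') hc' hs'
  have e1 := integrable_mul_of_locallyIntegrableOn hg hθ'.continuous hc' hs'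
  have e2 := integrable_mul_of_locallyIntegrableOn hh hθ'.continuous hc' hs'
  have e3 : (fun x => θ x • (g - h) x) = fun x => g x * (θ x : ℂ) - h x * (θ x : ℂ) := by
    ext x; simp; ring
  rw [e3, integral_sub e1 e2, sub_eq_zero]
  exact this

theorem ae_eq_of_forall_integral_mul_eq {g h : Rn n → ℂ}
    (hg : LocallyIntegrable g volume) (hh : LocallyIntegrable h volume)
    (H : ∀ φ : 𝓢(Rn n, ℂ), HasCompactSupport φ → ∫ x, g x * φ x = ∫ x, h x * φ x) :
    g =ᵐ[volume] h := by
  filter_upwards [ae_eq_on_of_forall_integral_mul_eq isOpen_univ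
    (hg.locallyIntegrableOn univ) (hh.locallyIntegrableOn univ) (fun φ h1 _ => H φ h1)] with x hx
  exact hx trivial

/-- A bounded function of bounded support is an a.e. limit of uniformly bounded test functions whose
supports lie in a fixed ball. -/
theorem exists_schwartz_tendsto {φ : Rn n → ℂ} (hm : AEStronglyMeasurable φ volume) {M R : ℝ}
    (hM : ∀ x, ‖φ x‖ ≤ M) (hR : ∀ x, x ∉ closedBall 0 R → φ x = 0) :
    ∃ ψ : ℕ → 𝓢(Rn n, ℂ), (∀ j, HasCompactSupport (ψ j)) ∧ (∀ j x, ‖ψ j x‖ ≤ M) ∧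
      (∀ j x, x ∉ closedBall 0 (R + 1) → ψ j x = 0) ∧
      ∀ᵐ x ∂(volume : Measure (Rn n)), Tendsto (fun j => ψ j x) atTop (𝓝 (φ x)) := by
  have hM0 : 0 ≤ M := (norm_nonneg _).trans (hM 0)
  let B : ℕ → ContDiffBump (0 : Rn n) := fun j =>
    ⟨1 / (2 * ((j : ℝ) + 1)), 1 / ((j : ℝ) + 1), by positivity, by
      apply one_div_lt_one_div_of_lt <;> linarith [Nat.cast_nonneg (α := ℝ) j]⟩
  have hsupp : Function.support φ ⊆ closedBall 0 R := by
    intro x hx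
    by_contra h
    exact hx (hR x h)
  have hcs : HasCompactSupport φ :=
    HasCompactSupport.intro (isCompact_closedBall 0 R) hR
  have hint : Integrable φ volume := by
    rw [← integrableOn_iff_integrable_of_support_subset hsupp]
    exact Measure.integrableOn_of_bounded (isCompact_closedBall 0 R).measure_lt_top.ne
      hm (Eventually.of_forall fun x => hM x)
  have hloc : LocallyIntegrable φ volume := hint.locallyIntegrable
  let L := ContinuousLinearMap.lsmul ℝ ℝ (E := ℂ)
  let c : ℕ → Rn n → ℂ := fun j => convolution ((B j).normed volume) φ L volume
  have hcc : ∀ j, HasCompactSupport (c j) := fun j =>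
    HasCompactSupport.convolution L (B j).hasCompactSupport_normed hcs
  have hcd : ∀ j, ContDiff ℝ ((⊤ : ℕ∞) : WithTop ℕ∞) (c j) := fun j =>
    (B j).hasCompactSupport_normed.contDiff_convolution_left L (B j).contDiff_normed hloc
  refine ⟨fun j => (hcc j).toSchwartzMap (hcd j), hcc, ?_, ?_, ?_⟩
  · intro j x
    change ‖c j x‖ ≤ M
    have h1 : ‖c j x‖ ≤ ∫ t, ‖L ((B j).normed volume t) (φ (x - t))‖ :=
      norm_integral_le_integral_norm _
    have h2 : ∫ t, ‖L ((B j).normed volume t) (φ (x - t))‖ ≤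
        ∫ t, (B j).normed volume t * M := by
      apply integral_mono_of_nonneg (Eventually.of_forall fun _ => norm_nonneg _)
      · exact (B j).integrable_normed.mul_const M
      · refine Eventually.of_forall fun t => ?_
        simp only [L, ContinuousLinearMap.lsmul_apply, norm_smul, Real.norm_eq_abs]
        rw [abs_of_nonneg ((B j).nonneg_normed t)]
        exact mul_le_mul_of_nonneg_left (hM _) ((B j).nonneg_normed t)
    rw [integral_mul_const, (B j).integral_normed, one_mul] at h2
    exact h1.trans h2
  · intro j x hx
    change c j x = 0
    by_contra h
    obtain ⟨a, ha, b, hb, rfl⟩ := support_convolution_subset (L := L) h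
    apply hx
    rw [(B j).support_normed_eq] at ha
    have hb' := hsupp hb
    simp only [mem_closedBall, dist_zero_right, mem_ball] at *
    have h1 : (B j).rOut ≤ 1 := by
      change 1 / ((j : ℝ) + 1) ≤ 1
      rw [div_le_one (by positivity)]
      linarith [Nat.cast_nonneg (α := ℝ) j]
    linarith [norm_add_le a b]
  · apply ContDiffBump.ae_convolution_tendsto_right_of_locallyIntegrable (K := 2) _ _ hloc
    · exact tendsto_one_div_add_atTop_nhds_zero_nat
    · refine Eventually.of_forall fun j => ?_
      change 1 / ((j : ℝ) + 1) ≤ 2 * (1 / (2 * ((j : ℝ) + 1)))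
      apply le_of_eq
      field_simp

theorem enorm_integral_mul_le_of_schwartz {h : Rn n → ℂ} (hh : LocallyIntegrable h volume)
    {r : ℝ} (hr : 0 < r) {B : ℝ≥0}
    (H : ∀ φ : 𝓢(Rn n, ℂ), HasCompactSupport φ →
      ‖∫ x, h x * φ x‖ₑ ≤ B * (∫⁻ x, ‖φ x‖ₑ ^ r) ^ (1 / r))
    {φ : Rn n → ℂ} (hm : AEStronglyMeasurable φ volume) {M R : ℝ}
    (hM : ∀ x, ‖φ x‖ ≤ M) (hR : ∀ x, x ∉ closedBall 0 R → φ x = 0) :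
    ‖∫ x, h x * φ x‖ₑ ≤ B * (∫⁻ x, ‖φ x‖ₑ ^ r) ^ (1 / r) := by
  obtain ⟨ψ, hψc, hψM, hψR, hψ⟩ := exists_schwartz_tendsto hm hM hR
  have hM0 : 0 ≤ M := (norm_nonneg _).trans (hM 0)
  have hK : volume (closedBall (0 : Rn n) (R + 1)) ≠ ∞ :=
    (isCompact_closedBall 0 (R + 1)).measure_lt_top.ne
  have hhK : IntegrableOn h (closedBall 0 (R + 1)) volume :=
    hh.integrableOn_isCompact (isCompact_closedBall _ _)
  have t1 : Tendsto (fun j => ∫ x, h x * ψ j x) atTop (𝓝 (∫ x, h x * φ x)) := by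
    apply tendsto_integral_of_dominated_convergence
      ((closedBall (0 : Rn n) (R + 1)).indicator fun x => ‖h x‖ * M)
    · exact fun j => hh.aestronglyMeasurable.mul (ψ j).continuous.aestronglyMeasurable
    · rw [integrable_indicator_iff measurableSet_closedBall]
      exact hhK.norm.mul_const M
    · refine fun j => Eventually.of_forall fun x => ?_
      by_cases hx : x ∈ closedBall (0 : Rn n) (R + 1)
      · rw [indicator_of_mem hx, norm_mul]
        exact mul_le_mul_of_nonneg_left (hψM j x) (norm_nonneg _)
      · rw [indicator_of_notMem hx, hψR j x hx]
        simp
    · filter_upwards [hψ] with x hx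
      exact hx.const_mul _
  have t2 : Tendsto (fun j => ∫⁻ x, ‖ψ j x‖ₑ ^ r) atTop (𝓝 (∫⁻ x, ‖φ x‖ₑ ^ r)) := by
    apply tendsto_lintegral_of_dominated_convergence'
      ((closedBall (0 : Rn n) (R + 1)).indicator fun _ => ENNReal.ofReal M ^ r)
    · exact fun j => ((ψ j).continuous.measurable.enorm.pow_const r).aemeasurable
    · refine fun j => Eventually.of_forall fun x => ?_
      by_cases hx : x ∈ closedBall (0 : Rn n) (R + 1)
      · rw [indicator_of_mem hx]
        refine ENNReal.rpow_le_rpow ?_ hr.le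
        rw [← ofReal_norm]
        exact ENNReal.ofReal_le_ofReal (hψM j x)
      · simp only [indicator_of_notMem hx, hψR j x hx]
        simp [hr]
    · rw [lintegral_indicator_const measurableSet_closedBall]
      exact ENNReal.mul_ne_top (ENNReal.rpow_ne_top_of_nonneg hr.le ENNReal.ofReal_ne_top) hK
    · filter_upwards [hψ] with x hx
      exact (ENNReal.continuous_rpow_const.tendsto _).comp ((continuous_enorm.tendsto _).comp hx)
  have t3 : Tendsto (fun j => B * (∫⁻ x, ‖ψ j x‖ₑ ^ r) ^ (1 / r)) atTop
      (𝓝 (B * (∫⁻ x, ‖φ x‖ₑ ^ r) ^ (1 / r))) :=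
    ENNReal.Tendsto.const_mul ((ENNReal.continuous_rpow_const.tendsto _).comp t2)
      (Or.inr ENNReal.coe_ne_top)
  exact le_of_tendsto_of_tendsto' ((continuous_enorm.tendsto _).comp t1) t3
    (fun j => H (ψ j) (hψc j))

/-- The converse of Hölder's inequality, with test functions. -/
theorem lintegral_rpow_le_of_schwartz {h : Rn n → ℂ} (hh : LocallyIntegrable h volume)
    {q r : ℝ} (hqr : q.HolderConjugate r) {B : ℝ≥0}
    (H : ∀ φ : 𝓢(Rn n, ℂ), HasCompactSupport φ →
      ‖∫ x, h x * φ x‖ₑ ≤ B * (∫⁻ x, ‖φ x‖ₑ ^ r) ^ (1 / r)) :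
    ∫⁻ x, ‖h x‖ₑ ^ q ≤ (B : ℝ≥0∞) ^ q := by
  have hq : 0 < q := hqr.pos
  have hr : 0 < r := hqr.symm.pos
  wlog hsm : StronglyMeasurable h generalizing h
  · have hae := hh.aestronglyMeasurable.ae_eq_mk
    have hsm' := hh.aestronglyMeasurable.stronglyMeasurable_mk
    generalize hh.aestronglyMeasurable.mk h = h' at hae hsm'
    have e : ∀ φ : Rn n → ℂ, ∫ x, h' x * φ x = ∫ x, h x * φ x := fun φ =>
      integral_congr_ae (hae.mono fun x hx => by simp only [hx])
    refine (lintegral_congr_ae (hae.mono fun x hx => by simp only [hx])).trans_le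
      (this (hh.congr hae) (fun φ hφ => ?_) hsm')
    rw [e]
    exact H φ hφ
  let A : ℕ → Set (Rn n) := fun N => {x | ‖h x‖ ≤ N} ∩ closedBall 0 N
  have hA : ∀ N, MeasurableSet (A N) := fun N =>
    (measurableSet_le hsm.measurable.norm measurable_const).inter measurableSet_closedBall
  have step : ∀ N, ∫⁻ x in A N, ‖h x‖ₑ ^ q ≤ (B : ℝ≥0∞) ^ q := by
    intro N
    set I := ∫⁻ x in A N, ‖h x‖ₑ ^ q with hI
    let φ : Rn n → ℂ := (A N).indicator fun x => (starRingEnd ℂ) (h x) * ((‖h x‖ ^ (q - 2) : ℝ) : ℂ)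
    have hφm : AEStronglyMeasurable φ volume := by
      apply Measurable.aestronglyMeasurable
      refine Measurable.indicator ?_ (hA N)
      exact (Complex.continuous_conj.measurable.comp hsm.measurable).mul
        (Complex.measurable_ofReal.comp (hsm.measurable.norm.pow_const _))
    have hnorm : ∀ x, ‖(starRingEnd ℂ) (h x) * ((‖h x‖ ^ (q - 2) : ℝ) : ℂ)‖ = ‖h x‖ ^ (q - 1) := by
      intro x
      rw [norm_mul, RCLike.norm_conj, Complex.norm_real, Real.norm_of_nonneg (by positivity)]
      rcases eq_or_ne (‖h x‖) 0 with h0 | h0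
      · rw [h0, zero_mul, Real.zero_rpow (by linarith [hqr.lt])]
      · rw [← Real.rpow_one_add' (norm_nonneg _) (by linarith [hqr.lt])]
        congr 1; ring
    have hφM : ∀ x, ‖φ x‖ ≤ (N : ℝ) ^ (q - 1) := by
      intro x
      by_cases hx : x ∈ A N
      · simp only [φ, indicator_of_mem hx]
        rw [hnorm]
        exact Real.rpow_le_rpow (norm_nonneg _) hx.1 (by linarith [hqr.lt])
      · simp only [φ, indicator_of_notMem hx, norm_zero]
        positivity
    have hφR : ∀ x, x ∉ closedBall (0 : Rn n) N → φ x = 0 := fun x hx =>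
      indicator_of_notMem (fun hx' => hx hx'.2) _
    have key := enorm_integral_mul_le_of_schwartz hh hr H hφm hφM hφR
    have e1 : ∫⁻ x, ‖φ x‖ₑ ^ r = I := by
      rw [hI, ← lintegral_indicator (hA N)]
      refine lintegral_congr fun x => ?_
      by_cases hx : x ∈ A N
      · simp only [φ, indicator_of_mem hx]
        rw [← ofReal_norm, hnorm, ← ofReal_norm, ENNReal.ofReal_rpow_of_nonneg (by positivity) hr.le,
          ENNReal.ofReal_rpow_of_nonneg (by positivity) hq.le, ← Real.rpow_mul (norm_nonneg _),
          hqr.sub_one_mul_conj]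
      · simp only [φ, indicator_of_notMem hx]
        simp [hr]
    have hbd : IntegrableOn (fun x => ‖h x‖ ^ q) (A N) volume := by
      apply Measure.integrableOn_of_bounded (M := (N : ℝ) ^ q)
      · exact ((measure_mono inter_subset_right).trans_lt
          (isCompact_closedBall (0 : Rn n) N).measure_lt_top).ne
      · exact (hsm.measurable.norm.pow_const _).aestronglyMeasurable
      · filter_upwards [ae_restrict_mem (hA N)] with x hx
        rw [Real.norm_of_nonneg (by positivity)]
        exact Real.rpow_le_rpow (norm_nonneg _) hx.1 hq.le
    have e2 : ‖∫ x, h x * φ x‖ₑ = I := by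
      have : ∀ x, h x * φ x = (((A N).indicator (fun x => ‖h x‖ ^ q) x : ℝ) : ℂ) := by
        intro x
        by_cases hx : x ∈ A N
        · simp only [φ, indicator_of_mem hx]
          rw [← mul_assoc, Complex.mul_conj, Complex.normSq_eq_norm_sq, ← Complex.ofReal_mul]
          congr 1
          rcases eq_or_ne (‖h x‖) 0 with h0 | h0
          · rw [h0, Real.zero_rpow hq.ne']; simp
          · rw [← Real.rpow_natCast, ← Real.rpow_add (by positivity)]
            congr 1; push_cast; ring
        · simp [φ, indicator_of_notMem hx]
      simp_rw [this]
      rw [integral_complex_ofReal, integral_indicator (hA N), ← ofReal_norm, Complex.norm_real,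
        Real.norm_of_nonneg (integral_nonneg fun _ => by positivity),
        ofReal_integral_eq_lintegral_ofReal hbd (Eventually.of_forall fun _ => by positivity)]
      refine lintegral_congr fun x => ?_
      rw [← ofReal_norm, ENNReal.ofReal_rpow_of_nonneg (by positivity) hq.le]
    have hIt : I ≠ ∞ := by rw [← e2]; exact enorm_ne_top
    rw [e1, e2] at key
    rcases eq_or_ne I 0 with h0 | h0
    · rw [h0]; exact zero_le
    · have h3 : I ^ (1 / q) ≤ B := by
        have h4 : I = I ^ (1 / q) * I ^ (1 / r) := by
          rw [← ENNReal.rpow_add _ _ h0 hIt, one_div, one_div, hqr.inv_add_inv_eq_one,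
            ENNReal.rpow_one]
        have key : I ^ (1 / q) * I ^ (1 / r) ≤ B * I ^ (1 / r) := h4.symm.trans_le key
        have h5 : I ^ (1 / r) ≠ 0 := by simp [h0, hIt]
        have h6 : I ^ (1 / r) ≠ ∞ := by simp [h0, hIt]
        exact (ENNReal.mul_le_mul_iff_left h5 h6).1 key
      calc I = (I ^ (1 / q)) ^ q := by
            rw [← ENNReal.rpow_mul, one_div, inv_mul_cancel₀ hq.ne', ENNReal.rpow_one]
        _ ≤ _ := ENNReal.rpow_le_rpow h3 hq.le
  have hmono : Monotone A := by
    intro a b hab x hx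
    have : (a : ℝ) ≤ b := by exact_mod_cast hab
    exact ⟨le_trans hx.1 this, closedBall_subset_closedBall this hx.2⟩
  have hU : ⋃ N, A N = univ := by
    refine eq_univ_of_forall fun x => mem_iUnion.2 ?_
    obtain ⟨N, hN⟩ := exists_nat_ge (max ‖h x‖ ‖x‖)
    exact ⟨N, (le_max_left _ _).trans hN, by
      simpa using (le_max_right _ _).trans hN⟩
  rw [← setLIntegral_univ, ← hU, setLIntegral_iUnion_of_directed _ hmono.directed_le]
  exact iSup_le step

/-- The index of the dyadic cube of side `2⁻ᵏ` that contains `x`. -/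
noncomputable def dyadicIndex (k : ℤ) (x : Rn n) : Fin n → ℤ := fun i => ⌊x i * (2 : ℝ) ^ k⌋

/-- The dyadic cube of side `2⁻ᵏ` with index `m`. -/
noncomputable def dyadicCube (j : ℤ × (Fin n → ℤ)) : Set (Rn n) := {x | dyadicIndex j.1 x = j.2}

/-- The radius of a ball that contains the dyadic cube of side `2⁻ᵏ` around any of its points. -/
noncomputable def dyadicRadius (n : ℕ) (k : ℤ) : ℝ := (√n + 1) * (2 : ℝ) ^ (-k)

theorem mem_dyadicCube_self (k : ℤ) (x : Rn n) : x ∈ dyadicCube (k, dyadicIndex k x) := rfl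

theorem dyadicCube_eq_preimage (j : ℤ × (Fin n → ℤ)) :
    dyadicCube j = (MeasurableEquiv.toLp 2 (Fin n → ℝ)).symm ⁻¹'
      (univ.pi fun i => Ico ((j.2 i : ℝ) * 2 ^ (-j.1)) (((j.2 i : ℝ) + 1) * 2 ^ (-j.1))) := by
  have h2 : (0 : ℝ) < 2 ^ j.1 := by positivity
  ext x
  simp only [dyadicCube, dyadicIndex, mem_ofPred_eq, mem_preimage, mem_univ_pi, mem_Ico, funext_iff,
    Int.floor_eq_iff, zpow_neg]
  refine forall_congr' fun i => ?_
  rw [← div_eq_mul_inv, ← div_eq_mul_inv, div_le_iff₀ h2, lt_div_iff₀ h2]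
  rfl

theorem measurableSet_dyadicCube (j : ℤ × (Fin n → ℤ)) : MeasurableSet (dyadicCube j) := by
  rw [dyadicCube_eq_preimage]
  exact (MeasurableEquiv.toLp 2 (Fin n → ℝ)).symm.measurable
    (MeasurableSet.univ_pi fun _ => measurableSet_Ico)

theorem volume_dyadicCube (j : ℤ × (Fin n → ℤ)) :
    volume (dyadicCube j) = ENNReal.ofReal (((2 : ℝ) ^ (-j.1)) ^ n) := by
  rw [dyadicCube_eq_preimage,
    (EuclideanSpace.volume_preserving_symm_measurableEquiv_toLp (Fin n)).measure_preimage
      (MeasurableSet.univ_pi fun _ => measurableSet_Ico).nullMeasurableSet, Real.volume_pi_Ico]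
  have : ∀ i, ((j.2 i : ℝ) + 1) * 2 ^ (-j.1) - (j.2 i : ℝ) * 2 ^ (-j.1) = 2 ^ (-j.1) := by
    intro i; ring
  simp only [this, Finset.prod_const, Finset.card_univ, Fintype.card_fin]
  rw [ENNReal.ofReal_pow (by positivity)]

theorem volume_dyadicCube_ne_zero (j : ℤ × (Fin n → ℤ)) : volume (dyadicCube j) ≠ 0 := by
  rw [volume_dyadicCube]
  exact (ENNReal.ofReal_pos.2 (by positivity)).ne'

theorem volume_dyadicCube_ne_top (j : ℤ × (Fin n → ℤ)) : volume (dyadicCube j) ≠ ∞ := by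
  rw [volume_dyadicCube]
  exact ENNReal.ofReal_ne_top

theorem volume_dyadicCube_pred (k : ℤ) (m m' : Fin n → ℤ) :
    volume (dyadicCube (k - 1, m')) = 2 ^ n * volume (dyadicCube (k, m)) := by
  rw [volume_dyadicCube, volume_dyadicCube]
  have : (2 : ℝ) ^ (-(k - 1)) = 2 * 2 ^ (-k) := by
    rw [← zpow_one_add₀ two_ne_zero]; congr 1; ring
  simp only [this, mul_pow]
  rw [ENNReal.ofReal_mul (by positivity), ENNReal.ofReal_pow (by positivity)]
  simp

theorem dyadicRadius_pos (n : ℕ) (k : ℤ) : 0 < dyadicRadius n k := by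
  unfold dyadicRadius; positivity

theorem dist_le_of_mem_dyadicCube {j : ℤ × (Fin n → ℤ)} {x y : Rn n} (hx : x ∈ dyadicCube j)
    (hy : y ∈ dyadicCube j) : dist x y ≤ dyadicRadius n j.1 := by
  have h2 : (0 : ℝ) < 2 ^ j.1 := by positivity
  have hi : ∀ i, dist (x i) (y i) ^ 2 ≤ ((2 : ℝ) ^ (-j.1)) ^ 2 := by
    intro i
    have h1 : ⌊x i * (2 : ℝ) ^ j.1⌋ = ⌊y i * (2 : ℝ) ^ j.1⌋ :=
      (congrFun hx i).trans (congrFun hy i).symm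
    have h3 := Int.abs_sub_lt_one_of_floor_eq_floor h1
    rw [← sub_mul, abs_mul, abs_of_pos h2, ← lt_div_iff₀ h2, one_div, ← zpow_neg] at h3
    rw [Real.dist_eq]
    gcongr
  rw [EuclideanSpace.dist_eq]
  calc √(∑ i, dist (x i) (y i) ^ 2) ≤ √(∑ _i : Fin n, ((2 : ℝ) ^ (-j.1)) ^ 2) :=
        Real.sqrt_le_sqrt (Finset.sum_le_sum fun i _ => hi i)
    _ = √n * 2 ^ (-j.1) := by
        rw [Finset.sum_const, Finset.card_univ, Fintype.card_fin, nsmul_eq_mul,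
          Real.sqrt_mul (by positivity), Real.sqrt_sq (by positivity)]
    _ ≤ _ := by unfold dyadicRadius; gcongr; linarith

theorem dyadicIndex_eq_of_le {k l : ℤ} (h : k ≤ l) {x y : Rn n}
    (hxy : dyadicIndex l x = dyadicIndex l y) : dyadicIndex k x = dyadicIndex k y := by
  obtain ⟨d, rfl⟩ := Int.le.dest h
  have key : ∀ z : Rn n, ∀ i, dyadicIndex k z i = dyadicIndex (k + d) z i / (2 ^ d : ℤ) := by
    intro z i
    have := Int.mul_cast_floor_div_cancel_of_pos (n := 2 ^ d) (by positivity) (z i * (2 : ℝ) ^ k)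
    rw [dyadicIndex, dyadicIndex, ← this, zpow_add₀ two_ne_zero, mul_assoc]
    simp
  ext i
  rw [key, key, hxy]

/-- The constant by which balls of radius `dyadicRadius n k` exceed dyadic cubes of side `2⁻ᵏ`. -/
noncomputable def ballCubeRatio (n : ℕ) : ℝ≥0 :=
  (ENNReal.ofReal ((√n + 1) ^ n) * volume (ball (0 : Rn n) 1)).toNNReal

theorem volume_closedBall_dyadicRadius (j : ℤ × (Fin n → ℤ)) (x : Rn n) {a : ℝ} (ha : 0 ≤ a) :
    volume (closedBall x (a * dyadicRadius n j.1)) =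
      ENNReal.ofReal (a ^ n) * ballCubeRatio n * volume (dyadicCube j) := by
  rw [Measure.addHaar_closedBall _ _ (mul_nonneg ha (dyadicRadius_pos n j.1).le), ballCubeRatio,
    ENNReal.coe_toNNReal, volume_dyadicCube, dyadicRadius, finrank_euclideanSpace_fin,
    ← mul_assoc, mul_pow, mul_pow, ENNReal.ofReal_mul (by positivity),
    ENNReal.ofReal_mul (by positivity)]
  · ring
  · exact ENNReal.mul_ne_top ENNReal.ofReal_ne_top measure_ball_lt_top.ne

theorem ae_enorm_le_of_dyadic_average_le {f : Rn n → ℂ} (hf : LocallyIntegrable f volume)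
    (t : ℝ≥0∞) : ∀ᵐ x ∂(volume : Measure (Rn n)),
      (∀ k : ℤ, ∫⁻ y in dyadicCube (k, dyadicIndex k x), ‖f y‖ₑ ≤
        t * volume (dyadicCube (k, dyadicIndex k x))) → ‖f x‖ₑ ≤ t := by
  filter_upwards [(Besicovitch.vitaliFamily volume).ae_tendsto_lintegral_enorm_sub_div hf]
    with x hx h
  have hr : Tendsto (fun k : ℕ => dyadicRadius n k) atTop (𝓝[>] 0) := by
    refine tendsto_nhdsWithin_iff.2 ⟨?_, Eventually.of_forall fun k => dyadicRadius_pos n k⟩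
    have : Tendsto (fun k : ℕ => (√n + 1) * (1 / 2 : ℝ) ^ k) atTop (𝓝 ((√n + 1) * 0)) :=
      (tendsto_pow_atTop_nhds_zero_of_lt_one (by norm_num) (by norm_num)).const_mul _
    rw [mul_zero] at this
    refine this.congr fun k => ?_
    simp [dyadicRadius]
  have h1 := hx.comp ((Besicovitch.tendsto_filterAt volume x).comp hr)
  have h2 : Tendsto (fun k : ℕ => t + ballCubeRatio n *
      ((∫⁻ y in closedBall x (dyadicRadius n k), ‖f y - f x‖ₑ) /
        volume (closedBall x (dyadicRadius n k)))) atTop (𝓝 (t + ballCubeRatio n * 0)) :=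
    (ENNReal.Tendsto.const_mul h1 (Or.inr ENNReal.coe_ne_top)).const_add _
  rw [mul_zero, add_zero] at h2
  refine ge_of_tendsto' h2 fun k => ?_
  set Q := dyadicCube ((k : ℤ), dyadicIndex (k : ℤ) x) with hQ
  set V := volume Q
  have hV0 : V ≠ 0 := volume_dyadicCube_ne_zero _
  have hVt : V ≠ ∞ := volume_dyadicCube_ne_top _
  have hQm : MeasurableSet Q := measurableSet_dyadicCube _
  set W := ∫⁻ y in closedBall x (dyadicRadius n k), ‖f y - f x‖ₑ
  have hVB : volume (closedBall x (dyadicRadius n k)) = ballCubeRatio n * V := by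
    simpa using volume_closedBall_dyadicRadius ((k : ℤ), dyadicIndex (k : ℤ) x) x zero_le_one
  have hB0 : (ballCubeRatio n : ℝ≥0∞) ≠ 0 := by
    intro h0
    rw [h0, zero_mul] at hVB
    exact (measure_closedBall_pos volume x (dyadicRadius_pos n k)).ne' hVB
  have key : ‖f x‖ₑ * V ≤ t * V + W := by
    calc ‖f x‖ₑ * V = ∫⁻ _ in Q, ‖f x‖ₑ := by rw [setLIntegral_const]
      _ ≤ ∫⁻ y in Q, (‖f y‖ₑ + ‖f y - f x‖ₑ) := by
          refine lintegral_mono fun y => ?_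
          have : f x = f y - (f y - f x) := by ring
          calc ‖f x‖ₑ = ‖f y - (f y - f x)‖ₑ := by rw [← this]
            _ ≤ _ := enorm_sub_le
      _ = (∫⁻ y in Q, ‖f y‖ₑ) + ∫⁻ y in Q, ‖f y - f x‖ₑ :=
          lintegral_add_left' hf.aestronglyMeasurable.enorm.restrict _
      _ ≤ t * V + W := by
          refine add_le_add (h k) (lintegral_mono_set fun y hy => ?_)
          exact mem_closedBall.2 (dist_le_of_mem_dyadicCube hy (mem_dyadicCube_self _ x))
  rw [hVB, ENNReal.div_eq_inv_mul, ENNReal.mul_inv (Or.inl hB0) (Or.inl ENNReal.coe_ne_top),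
    ← mul_assoc, ← mul_assoc, ENNReal.mul_inv_cancel hB0 ENNReal.coe_ne_top, one_mul]
  calc ‖f x‖ₑ = ‖f x‖ₑ * V * V⁻¹ := by
        rw [mul_assoc, ENNReal.mul_inv_cancel hV0 hVt, mul_one]
    _ ≤ (t * V + W) * V⁻¹ := by gcongr
    _ = t + V⁻¹ * W := by
        rw [add_mul, mul_assoc, ENNReal.mul_inv_cancel hV0 hVt, mul_one, mul_comm W]

/-- A dyadic cube on which the mean of `|f|` exceeds `t`. -/
def HighMean (f : Rn n → ℂ) (t : ℝ≥0∞) (j : ℤ × (Fin n → ℤ)) : Prop :=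
  t * volume (dyadicCube j) < ∫⁻ y in dyadicCube j, ‖f y‖ₑ

/-- The maximal dyadic cubes on which the mean of `|f|` exceeds `t`. -/
def stoppingCubes (f : Rn n → ℂ) (t : ℝ≥0∞) : Set (ℤ × (Fin n → ℤ)) :=
  {j | HighMean f t j ∧
    ∀ x ∈ dyadicCube j, ∀ k < j.1, ¬ HighMean f t (k, dyadicIndex k x)}

theorem pairwiseDisjoint_stoppingCubes (f : Rn n → ℂ) (t : ℝ≥0∞) :
    (stoppingCubes f t).PairwiseDisjoint dyadicCube := by
  have aux : ∀ i ∈ stoppingCubes f t, ∀ j ∈ stoppingCubes f t, ∀ x ∈ dyadicCube i,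
      x ∈ dyadicCube j → ¬ i.1 < j.1 := by
    intro i hi j hj x hxi hxj hlt
    have := hj.2 x hxj i.1 hlt
    rw [show dyadicIndex i.1 x = i.2 from hxi] at this
    exact this hi.1
  intro i hi j hj hij
  refine disjoint_left.2 fun x hxi hxj => hij ?_
  have h1 : i.1 = j.1 := le_antisymm (not_lt.1 (aux j hj i hi x hxj hxi))
    (not_lt.1 (aux i hi j hj x hxi hxj))
  refine Prod.ext h1 ?_
  rw [← show dyadicIndex i.1 x = i.2 from hxi, ← show dyadicIndex j.1 x = j.2 from hxj, h1]

theorem lintegral_le_of_mem_stoppingCubes {f : Rn n → ℂ} {t : ℝ≥0∞} {j : ℤ × (Fin n → ℤ)}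
    (hj : j ∈ stoppingCubes f t) :
    ∫⁻ y in dyadicCube j, ‖f y‖ₑ ≤ 2 ^ n * t * volume (dyadicCube j) := by
  obtain ⟨k, m⟩ := j
  have hne : (dyadicCube (k, m)).Nonempty := by
    by_contra h
    exact volume_dyadicCube_ne_zero (k, m) (by rw [not_nonempty_iff_eq_empty.1 h, measure_empty])
  obtain ⟨x, hx⟩ := hne
  have h1 := hj.2 x hx (k - 1) (by simp)
  rw [HighMean, not_lt] at h1
  have hsub : dyadicCube (k, m) ⊆ dyadicCube (k - 1, dyadicIndex (k - 1) x) := by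
    intro y hy
    exact dyadicIndex_eq_of_le (by simp) ((show dyadicIndex k y = m from hy).trans
      (show dyadicIndex k x = m from hx).symm)
  calc ∫⁻ y in dyadicCube (k, m), ‖f y‖ₑ
      ≤ ∫⁻ y in dyadicCube (k - 1, dyadicIndex (k - 1) x), ‖f y‖ₑ := lintegral_mono_set hsub
    _ ≤ t * volume (dyadicCube (k - 1, dyadicIndex (k - 1) x)) := h1
    _ = _ := by rw [volume_dyadicCube_pred k m]; ring

theorem exists_mem_stoppingCubes (hn : n ≠ 0) {f : Rn n → ℂ} (hf : ∫⁻ y, ‖f y‖ₑ ≠ ∞) {t : ℝ≥0∞}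
    (ht : t ≠ 0) {x : Rn n} {l : ℤ} (hl : HighMean f t (l, dyadicIndex l x)) :
    ∃ j ∈ stoppingCubes f t, x ∈ dyadicCube j := by
  obtain ⟨N, hN⟩ := ENNReal.exists_nat_mul_gt ht hf
  have hbdd : ∃ b : ℤ, ∀ z : ℤ, HighMean f t (z, dyadicIndex z x) → b ≤ z := by
    refine ⟨-N, fun z hz => ?_⟩
    by_contra hlt
    push Not at hlt
    have h1 : (N : ℝ) ≤ ((2 : ℝ) ^ (-z)) ^ n := by
      have a : (N : ℝ) ≤ 2 ^ N := by exact_mod_cast Nat.lt_two_pow_self.le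
      have b : (2 : ℝ) ^ N ≤ 2 ^ (-z) := by
        rw [← zpow_natCast]
        exact zpow_le_zpow_right₀ one_le_two (by linarith)
      have c : (1 : ℝ) ≤ 2 ^ (-z) := le_trans (one_le_pow₀ one_le_two) b
      exact (a.trans b).trans (le_self_pow₀ c hn)
    have h2 : (N : ℝ≥0∞) ≤ volume (dyadicCube (z, dyadicIndex z x)) := by
      rw [volume_dyadicCube, ← ENNReal.ofReal_natCast]
      exact ENNReal.ofReal_le_ofReal h1
    have h3 : ∫⁻ y in dyadicCube (z, dyadicIndex z x), ‖f y‖ₑ ≤ ∫⁻ y, ‖f y‖ₑ :=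
      setLIntegral_le_lintegral _ _
    have h4 : t * N ≤ t * volume (dyadicCube (z, dyadicIndex z x)) := by gcongr
    rw [mul_comm] at hN
    exact absurd (h4.trans_lt hz) (not_lt.2 (h3.trans hN.le))
  obtain ⟨k, hk, hmin⟩ := Int.exists_least_of_bdd hbdd ⟨l, hl⟩
  refine ⟨(k, dyadicIndex k x), ⟨hk, fun y hy k' hk' h => ?_⟩, mem_dyadicCube_self k x⟩
  rw [dyadicIndex_eq_of_le hk'.le (show dyadicIndex k y = dyadicIndex k x from hy)] at h
  exact absurd (hmin k' h) (not_le.2 hk')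

/-- The Calderón–Zygmund decomposition, with finitely many cubes. -/
theorem exists_calderonZygmund_cubes (hn : n ≠ 0) {f : Rn n → ℂ} (hf : Integrable f volume)
    (hf2 : MemLp f 2 volume) {t : ℝ≥0∞} (ht : t ≠ 0) :
    ∃ F : Finset (ℤ × (Fin n → ℤ)), (F : Set (ℤ × (Fin n → ℤ))).PairwiseDisjoint dyadicCube ∧
      (∀ j ∈ F, t * volume (dyadicCube j) ≤ ∫⁻ y in dyadicCube j, ‖f y‖ₑ) ∧
      (∀ j ∈ F, ∫⁻ y in dyadicCube j, ‖f y‖ₑ ≤ 2 ^ n * t * volume (dyadicCube j)) ∧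
      ∫⁻ x in (⋃ j ∈ F, dyadicCube j)ᶜ, ‖f x‖ₑ ^ 2 ≤ 2 * t * ∫⁻ x, ‖f x‖ₑ := by
  classical
  set J := stoppingCubes f t with hJ
  have hfin : ∫⁻ y, ‖f y‖ₑ ≠ ∞ := hf.2.ne
  have hsq : ∫⁻ y, ‖f y‖ₑ ^ 2 ≠ ∞ := by
    have := hf2.2
    rw [eLpNorm_lt_top_iff_lintegral_rpow_enorm_lt_top (by norm_num) (by norm_num)] at this
    simpa using this.ne
  by_cases h0 : ∫⁻ y, ‖f y‖ₑ = 0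
  · refine ⟨∅, by simp, by simp, by simp, ?_⟩
    rw [lintegral_eq_zero_iff' hf.aestronglyMeasurable.enorm] at h0
    rw [lintegral_congr_ae (g := fun _ => 0)]
    · simp
    · refine ae_restrict_of_ae ?_
      filter_upwards [h0] with x hx
      simp [show ‖f x‖ₑ = 0 from hx]
  set Ω := ⋃ j : J, dyadicCube j.1 with hΩ
  have hdisj : Pairwise (Function.onFun Disjoint fun j : J => dyadicCube j.1) := by
    intro i j hij
    exact pairwiseDisjoint_stoppingCubes f t i.2 j.2 (fun h => hij (Subtype.ext h))
  have hsum : ∑' j : J, ∫⁻ x in dyadicCube j.1, ‖f x‖ₑ ^ 2 ≠ ∞ := by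
    rw [← lintegral_iUnion (fun j => measurableSet_dyadicCube _) hdisj]
    exact ((setLIntegral_le_lintegral _ _).trans_lt hsq.lt_top).ne
  have htail := ENNReal.tendsto_tsum_compl_atTop_zero hsum
  have hpos : 0 < t * ∫⁻ y, ‖f y‖ₑ := pos_iff_ne_zero.2 (mul_ne_zero ht h0)
  obtain ⟨F', hF'⟩ := (htail.eventually (gt_mem_nhds hpos)).exists
  refine ⟨F'.map (Function.Embedding.subtype _), ?_, ?_, ?_, ?_⟩
  · refine (pairwiseDisjoint_stoppingCubes f t).subset ?_
    intro j hj
    simp only [Finset.coe_map, Function.Embedding.subtype_apply, mem_image] at hj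
    obtain ⟨i, -, rfl⟩ := hj
    exact i.2
  · intro j hj
    obtain ⟨i, -, rfl⟩ := Finset.mem_map.1 hj
    exact i.2.1.le
  · intro j hj
    obtain ⟨i, -, rfl⟩ := Finset.mem_map.1 hj
    exact lintegral_le_of_mem_stoppingCubes i.2
  · have hcov : (⋃ j ∈ F'.map (Function.Embedding.subtype _), dyadicCube j)ᶜ ⊆
        Ωᶜ ∪ ⋃ j : {j // j ∉ F'}, dyadicCube j.1.1 := by
      intro x hx
      by_cases hxΩ : x ∈ Ω
      · right
        obtain ⟨j, hj⟩ := mem_iUnion.1 hxΩ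
        refine mem_iUnion.2 ⟨⟨j, fun hjF => hx ?_⟩, hj⟩
        exact mem_iUnion₂.2 ⟨j.1, Finset.mem_map_of_mem _ hjF, hj⟩
      · left; exact hxΩ
    have hΩc : ∫⁻ x in Ωᶜ, ‖f x‖ₑ ^ 2 ≤ t * ∫⁻ x, ‖f x‖ₑ := by
      calc ∫⁻ x in Ωᶜ, ‖f x‖ₑ ^ 2 ≤ ∫⁻ x in Ωᶜ, t * ‖f x‖ₑ := by
            have hΩm : MeasurableSet Ωᶜ :=
              (MeasurableSet.iUnion fun j => measurableSet_dyadicCube _).compl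
            refine lintegral_mono_ae ((ae_restrict_iff' hΩm).2 ?_)
            filter_upwards [ae_enorm_le_of_dyadic_average_le hf.locallyIntegrable t] with x hx hxΩ
            rw [sq]
            gcongr
            refine hx fun k => ?_
            by_contra hk
            obtain ⟨j, hj, hxj⟩ := exists_mem_stoppingCubes hn hfin ht (not_le.1 hk)
            exact hxΩ (mem_iUnion.2 ⟨⟨j, hj⟩, hxj⟩)
        _ ≤ ∫⁻ x, t * ‖f x‖ₑ := setLIntegral_le_lintegral _ _
        _ = _ := lintegral_const_mul'' _ hf.aestronglyMeasurable.enorm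
    calc _ ≤ ∫⁻ x in Ωᶜ ∪ ⋃ j : {j // j ∉ F'}, dyadicCube j.1.1, ‖f x‖ₑ ^ 2 :=
          lintegral_mono_set hcov
      _ ≤ (∫⁻ x in Ωᶜ, ‖f x‖ₑ ^ 2) + ∫⁻ x in ⋃ j : {j // j ∉ F'}, dyadicCube j.1.1, ‖f x‖ₑ ^ 2 :=
          lintegral_union_le _ _ _
      _ ≤ t * (∫⁻ x, ‖f x‖ₑ) + t * ∫⁻ x, ‖f x‖ₑ :=
          add_le_add hΩc ((lintegral_iUnion_le _ _).trans hF'.le)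
      _ = _ := by ring

section Exponents

variable {α : Type*} [MeasurableSpace α] {μ : Measure α}

theorem eLpNorm_ofReal_eq {f : α → ℂ} {q : ℝ} (hq : 0 < q) :
    eLpNorm f (ENNReal.ofReal q) μ = (∫⁻ x, ‖f x‖ₑ ^ q ∂μ) ^ (1 / q) := by
  rw [eLpNorm_eq_lintegral_rpow_enorm_toReal (ENNReal.ofReal_pos.2 hq).ne' ENNReal.ofReal_ne_top,
    ENNReal.toReal_ofReal hq.le]

theorem lintegral_rpow_eq_eLpNorm {f : α → ℂ} {q : ℝ} (hq : 0 < q) :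
    ∫⁻ x, ‖f x‖ₑ ^ q ∂μ = eLpNorm f (ENNReal.ofReal q) μ ^ q := by
  rw [eLpNorm_ofReal_eq hq, ← ENNReal.rpow_mul, one_div, inv_mul_cancel₀ hq.ne', ENNReal.rpow_one]

theorem memLp_ofReal_iff {f : α → ℂ} {q : ℝ} (hq : 0 < q) :
    MemLp f (ENNReal.ofReal q) μ ↔ AEStronglyMeasurable f μ ∧ ∫⁻ x, ‖f x‖ₑ ^ q ∂μ < ∞ := by
  rw [MemLp, eLpNorm_lt_top_iff_lintegral_rpow_enorm_lt_top (ENNReal.ofReal_pos.2 hq).ne'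
    ENNReal.ofReal_ne_top, ENNReal.toReal_ofReal hq.le]

theorem eLpNorm_le_mul_iff {f g : α → ℂ} {q : ℝ} (hq : 0 < q) {C : ℝ≥0∞} :
    eLpNorm f (ENNReal.ofReal q) μ ≤ C * eLpNorm g (ENNReal.ofReal q) μ ↔
      ∫⁻ x, ‖f x‖ₑ ^ q ∂μ ≤ C ^ q * ∫⁻ x, ‖g x‖ₑ ^ q ∂μ := by
  rw [lintegral_rpow_eq_eLpNorm hq, lintegral_rpow_eq_eLpNorm hq, ← ENNReal.mul_rpow_of_nonneg _ _
    hq.le, ENNReal.rpow_le_rpow_iff hq]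

theorem tendsto_integral_mul_of_tendsto_eLpNorm {q r : ℝ} (hqr : q.HolderConjugate r)
    {F : ℕ → α → ℂ} {f h : α → ℂ} (hF : ∀ j, MemLp (F j) (ENNReal.ofReal q) μ)
    (hf : MemLp f (ENNReal.ofReal q) μ) (hh : MemLp h (ENNReal.ofReal r) μ)
    (ht : Tendsto (fun j => eLpNorm (F j - f) (ENNReal.ofReal q) μ) atTop (𝓝 0)) :
    Tendsto (fun j => ∫ x, F j x * h x ∂μ) atTop (𝓝 (∫ x, f x * h x ∂μ)) := by
  have : ENNReal.HolderConjugate (ENNReal.ofReal q) (ENNReal.ofReal r) := hqr.ennrealOfReal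
  have hint : ∀ j, Integrable (fun x => F j x * h x) μ := fun j => (hF j).integrable_mul hh
  refine tendsto_integral_of_L1' _ (MemLp.integrable_mul hf hh).1
    (Eventually.of_forall hint) ?_
  have hlim : Tendsto (fun j => eLpNorm (F j - f) (ENNReal.ofReal q) μ *
      eLpNorm h (ENNReal.ofReal r) μ) atTop (𝓝 0) := by
    simpa using ENNReal.Tendsto.mul_const ht (Or.inr hh.2.ne)
  refine tendsto_of_tendsto_of_tendsto_of_le_of_le tendsto_const_nhds hlim
    (fun _ => zero_le) fun j => ?_
  have e : (fun x => F j x * h x) - (fun x => f x * h x) = (F j - f) • h := by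
    ext x; simp [sub_mul]
  change eLpNorm ((fun x => F j x * h x) - fun x => f x * h x) 1 μ ≤ _
  rw [e]
  exact eLpNorm_smul_le_mul_eLpNorm hh.1 ((hF j).1.sub hf.1)

end Exponents

/-- A distribution with a bounded Fourier transform `m`, `|m| ≤ A`, that is given off the origin by
a standard Calderón–Zygmund kernel `k` with constant `c`. -/
structure KernelData (K : 𝓢'(Rn n, ℂ)) (k m : Rn n → ℂ) (A c : ℝ≥0) : Prop where
  meas : Measurable m
  bound : ∀ ξ, ‖m ξ‖ ≤ A
  mult : ∀ φ : 𝓢(Rn n, ℂ), K φ = ∫ ξ, 𝓕⁻ (φ : Rn n → ℂ) ξ * m ξ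
  eq_off_zero : ∀ φ : 𝓢(Rn n, ℂ), HasCompactSupport φ → (0 : Rn n) ∉ tsupport φ →
    K φ = ∫ x, k x * φ x
  size : ∀ x : Rn n, x ≠ 0 → ‖k x‖ ≤ c / ‖x‖ ^ n
  smooth : ∀ x y : Rn n, ‖y‖ < ‖x‖ / 2 → ‖k x - k (x - y)‖ ≤ c * ‖y‖ / ‖x‖ ^ (n + 1)

theorem IsCZKernel.exists_kernelData {K : 𝓢'(Rn n, ℂ)} {k : Rn n → ℂ} (h : IsCZKernel K k) :
    ∃ m A c, KernelData K k m A c := by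
  obtain ⟨M, hM⟩ := h.fourier_bounded
  obtain ⟨c₁, hc₁⟩ := h.size
  obtain ⟨c₂, hc₂⟩ := h.smooth
  have hMm := Lp.stronglyMeasurable M
  have hMb : ∀ᵐ ξ, ‖M ξ‖ ≤ ‖M‖ := by
    filter_upwards [ae_le_eLpNormEssSup (f := M) (μ := volume)] with ξ hξ
    rw [Lp.norm_def, eLpNorm_exponent_top, ← toReal_enorm]
    refine ENNReal.toReal_mono ?_ hξ
    rw [← eLpNorm_exponent_top]
    exact (Lp.memLp M).2.ne
  let m : Rn n → ℂ := {ξ | ‖M ξ‖ ≤ ‖M‖}.indicator M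
  have hmM : m =ᵐ[volume] M := by
    filter_upwards [hMb] with ξ hξ
    exact indicator_of_mem (show ξ ∈ {ξ | ‖M ξ‖ ≤ ‖M‖} from hξ) _
  refine ⟨m, ‖M‖₊, (max c₁ c₂).toNNReal, ?_, ?_, ?_, h.eq_off_zero, ?_, ?_⟩
  · exact hMm.measurable.indicator (measurableSet_le hMm.measurable.norm measurable_const)
  · intro ξ
    by_cases hξ : ξ ∈ {ξ | ‖M ξ‖ ≤ ‖M‖}
    · simp only [m, indicator_of_mem hξ]; exact hξ
    · simp [m, indicator_of_notMem hξ]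
  · intro φ
    have h1 : K φ = (𝓕 K) (𝓕⁻ φ) := by
      rw [TemperedDistribution.fourier_apply, FourierTransform.fourier_fourierInv_eq]
    rw [h1, hM, Lp.toTemperedDistribution_apply]
    refine integral_congr_ae ?_
    filter_upwards [hmM] with ξ hξ
    rw [hξ, smul_eq_mul, ← SchwartzMap.fourierInv_coe]
  · intro x hx
    refine (hc₁ x hx).trans ?_
    gcongr
    exact (le_max_left _ _).trans (Real.le_coe_toNNReal _)
  · intro x y hxy
    refine (hc₂ x y hxy).trans ?_
    gcongr
    exact (le_max_right _ _).trans (Real.le_coe_toNNReal _)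

/-- The reflection of a tempered distribution in the origin. -/
noncomputable def reflect (K : 𝓢'(Rn n, ℂ)) : 𝓢'(Rn n, ℂ) :=
  PointwiseConvergenceCLM.precomp _
    (SchwartzMap.compCLMOfContinuousLinearEquiv ℂ (ContinuousLinearEquiv.neg ℝ)) K

theorem reflect_apply (K : 𝓢'(Rn n, ℂ)) (φ : 𝓢(Rn n, ℂ)) :
    reflect K φ =
      K (SchwartzMap.compCLMOfContinuousLinearEquiv ℂ (ContinuousLinearEquiv.neg ℝ) φ) := rfl

namespace KernelData

variable {K : 𝓢'(Rn n, ℂ)} {k m : Rn n → ℂ} {A c : ℝ≥0}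

theorem reflect (h : KernelData K k m A c) :
    KernelData (reflect K) (fun x => k (-x)) (fun ξ => m (-ξ)) A c where
  meas := h.meas.comp measurable_neg
  bound ξ := h.bound _
  mult φ := by
    rw [reflect_apply, h.mult, ← integral_neg_eq_self]
    refine integral_congr_ae (Eventually.of_forall fun ξ => ?_)
    have e : ((SchwartzMap.compCLMOfContinuousLinearEquiv ℂ (ContinuousLinearEquiv.neg ℝ) φ :
        𝓢(Rn n, ℂ)) : Rn n → ℂ) = fun x => φ (-x) := rfl
    simp only [e]
    rw [Real.fourierInv_eq_fourier_neg, Real.fourierInv_eq_fourier_comp_neg φ, neg_neg]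
  eq_off_zero φ hφ h0 := by
    have h1 : HasCompactSupport (SchwartzMap.compCLMOfContinuousLinearEquiv ℂ
        (ContinuousLinearEquiv.neg ℝ) φ : 𝓢(Rn n, ℂ)) :=
      hφ.comp_homeomorph (Homeomorph.neg (Rn n))
    have h2 : (0 : Rn n) ∉ tsupport (SchwartzMap.compCLMOfContinuousLinearEquiv ℂ
        (ContinuousLinearEquiv.neg ℝ) φ : 𝓢(Rn n, ℂ)) := by
      intro h3
      have := tsupport_comp_subset_preimage φ (f := fun x : Rn n => -x) continuous_neg h3
      simp at this
      exact h0 this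
    rw [reflect_apply, h.eq_off_zero _ h1 h2, ← integral_neg_eq_self]
    simp
  size x hx := by simpa using h.size (-x) (neg_ne_zero.2 hx)
  smooth x y hxy := by
    have := h.smooth (-x) (-y) (by simpa using hxy)
    rw [norm_neg, norm_neg] at this
    convert this using 4
    abel

theorem integrable_fourierInv_mul (h : KernelData K k m A c) (φ : 𝓢(Rn n, ℂ)) :
    Integrable (fun ξ => 𝓕⁻ (φ : Rn n → ℂ) ξ * m ξ) volume := by
  have h1 : Integrable (𝓕⁻ (φ : Rn n → ℂ)) volume := by
    rw [← SchwartzMap.fourierInv_coe]; exact (𝓕⁻ φ).integrable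
  exact h1.mul_bdd (c := A) h.meas.aestronglyMeasurable (Eventually.of_forall h.bound)

theorem transposeConv_eq (h : KernelData K k m A c) (φ : 𝓢(Rn n, ℂ)) :
    transposeConv K φ = 𝓕 (fun ξ => 𝓕⁻ (φ : Rn n → ℂ) ξ * m ξ) := by
  ext y
  rw [transposeConv, h.mult, Real.fourier_eq]
  congr 1
  ext ξ
  have h1 : (φ.compSubConstCLM ℂ (-y) : Rn n → ℂ) = (φ : Rn n → ℂ) ∘ fun x => x + y := by
    ext x; simp
  have h2 := congrFun (VectorFourier.fourierIntegral_comp_add_right Real.fourierChar volume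
    (-innerₗ (Rn n)) (φ : Rn n → ℂ) y) ξ
  rw [h1]
  change VectorFourier.fourierIntegral Real.fourierChar volume (-innerₗ (Rn n)) _ ξ * _ = _
  rw [h2, smul_mul_assoc]
  congr 2
  simp [real_inner_comm]

theorem continuous_transposeConv (h : KernelData K k m A c) (φ : 𝓢(Rn n, ℂ)) :
    Continuous (transposeConv K φ) := by
  rw [h.transposeConv_eq]
  exact VectorFourier.fourierIntegral_continuous Real.continuous_fourierChar
    (by exact continuous_inner) (h.integrable_fourierInv_mul φ)

theorem norm_transposeConv_le (h : KernelData K k m A c) (φ : 𝓢(Rn n, ℂ)) (y : Rn n) :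
    ‖transposeConv K φ y‖ ≤ ∫ ξ, ‖𝓕⁻ (φ : Rn n → ℂ) ξ * m ξ‖ := by
  rw [h.transposeConv_eq]
  exact VectorFourier.norm_fourierIntegral_le_integral_norm _ _ _ _ _

theorem integral_transposeConv_mul_eq (h : KernelData K k m A c) (φ θ : 𝓢(Rn n, ℂ)) :
    ∫ x, transposeConv K φ x * θ x = ∫ ξ, 𝓕⁻ (φ : Rn n → ℂ) ξ * m ξ * 𝓕 (θ : Rn n → ℂ) ξ := by
  rw [h.transposeConv_eq]
  have := VectorFourier.integral_fourierIntegral_smul_eq_flip (L := innerₗ (Rn n))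
    Real.continuous_fourierChar (by exact continuous_inner) (h.integrable_fourierInv_mul φ)
    θ.integrable (μ := volume) (ν := volume)
  rw [flip_innerₗ] at this
  exact this

theorem integral_transposeConv_mul (h : KernelData K k m A c) (φ θ : 𝓢(Rn n, ℂ)) :
    ∫ x, transposeConv K φ x * θ x = ∫ x, φ x * transposeConv (VarLp.reflect K) θ x := by
  have h1 := h.reflect.integral_transposeConv_mul_eq θ φ
  simp_rw [mul_comm (φ _)]
  rw [h1, h.integral_transposeConv_mul_eq, ← integral_neg_eq_self]
  congr 1
  ext ξ
  rw [Real.fourierInv_eq_fourier_neg, Real.fourierInv_eq_fourier_neg, neg_neg]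
  ring

end KernelData

theorem lintegral_enorm_fourier_sq (θ : 𝓢(Rn n, ℂ)) :
    ∫⁻ ξ, ‖𝓕 (θ : Rn n → ℂ) ξ‖ₑ ^ (2 : ℝ) = ∫⁻ x, ‖θ x‖ₑ ^ (2 : ℝ) := by
  have key : ∀ f : 𝓢(Rn n, ℂ), ∫⁻ x, ‖f x‖ₑ ^ (2 : ℝ) = ENNReal.ofReal (∫ x, ‖f x‖ ^ 2) := by
    intro f
    rw [ofReal_integral_eq_lintegral_ofReal]
    · refine lintegral_congr fun x => ?_
      rw [ENNReal.ofReal_pow (norm_nonneg _), ofReal_norm, ENNReal.rpow_two]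
    · exact (f.memLp 2).integrable_norm_pow two_ne_zero
    · exact Eventually.of_forall fun x => by positivity
  rw [← SchwartzMap.fourier_coe, key, key, SchwartzMap.integral_norm_sq_fourier]

theorem lintegral_enorm_fourierInv_sq (θ : 𝓢(Rn n, ℂ)) :
    ∫⁻ ξ, ‖𝓕⁻ (θ : Rn n → ℂ) ξ‖ₑ ^ (2 : ℝ) = ∫⁻ x, ‖θ x‖ₑ ^ (2 : ℝ) := by
  rw [← SchwartzMap.fourierInv_coe, ← lintegral_enorm_fourier_sq, ← SchwartzMap.fourier_coe,
    FourierTransform.fourier_fourierInv_eq]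

theorem KernelData.enorm_integral_transposeConv_mul_le {K : 𝓢'(Rn n, ℂ)} {k m : Rn n → ℂ}
    {A c : ℝ≥0} (h : KernelData K k m A c) (φ θ : 𝓢(Rn n, ℂ)) :
    ‖∫ x, transposeConv K φ x * θ x‖ₑ ≤ A * eLpNorm φ (ENNReal.ofReal 2) volume *
      eLpNorm θ (ENNReal.ofReal 2) volume := by
  have hm : ∀ ξ, ‖m ξ‖ₑ ≤ A := fun ξ => by
    rw [← ofReal_norm]
    exact (ENNReal.ofReal_le_ofReal (h.bound ξ)).trans (by simp)
  rw [h.integral_transposeConv_mul_eq]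
  calc ‖∫ ξ, 𝓕⁻ (φ : Rn n → ℂ) ξ * m ξ * 𝓕 (θ : Rn n → ℂ) ξ‖ₑ
      ≤ ∫⁻ ξ, ‖𝓕⁻ (φ : Rn n → ℂ) ξ * m ξ * 𝓕 (θ : Rn n → ℂ) ξ‖ₑ := enorm_integral_le_lintegral_enorm _
    _ ≤ ∫⁻ ξ, A * (‖𝓕⁻ (φ : Rn n → ℂ) ξ‖ₑ * ‖𝓕 (θ : Rn n → ℂ) ξ‖ₑ) := by
        refine lintegral_mono fun ξ => ?_
        rw [enorm_mul, enorm_mul]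
        rw [mul_right_comm, mul_comm]
        exact mul_le_mul_left (hm ξ) _
    _ = A * ∫⁻ ξ, (‖𝓕⁻ (φ : Rn n → ℂ) ξ‖ₑ * ‖𝓕 (θ : Rn n → ℂ) ξ‖ₑ) :=
        lintegral_const_mul' _ _ ENNReal.coe_ne_top
    _ ≤ A * ((∫⁻ ξ, ‖𝓕⁻ (φ : Rn n → ℂ) ξ‖ₑ ^ (2 : ℝ)) ^ (1 / (2 : ℝ)) *
          (∫⁻ ξ, ‖𝓕 (θ : Rn n → ℂ) ξ‖ₑ ^ (2 : ℝ)) ^ (1 / (2 : ℝ))) := by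
        gcongr
        refine ENNReal.lintegral_mul_le_Lp_mul_Lq volume Real.HolderConjugate.two_two ?_ ?_
        · rw [← SchwartzMap.fourierInv_coe]
          exact (𝓕⁻ φ).continuous.enorm.aemeasurable
        · rw [← SchwartzMap.fourier_coe]
          exact (𝓕 θ).continuous.enorm.aemeasurable
    _ = _ := by
        rw [lintegral_enorm_fourier_sq, lintegral_enorm_fourierInv_sq, eLpNorm_ofReal_eq two_pos,
          eLpNorm_ofReal_eq two_pos, mul_assoc]

theorem KernelData.eLpNorm_two_transposeConv_le {K : 𝓢'(Rn n, ℂ)} {k m : Rn n → ℂ} {A c : ℝ≥0}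
    (h : KernelData K k m A c) (φ : 𝓢(Rn n, ℂ)) :
    eLpNorm (transposeConv K φ) (ENNReal.ofReal 2) volume ≤
      A * eLpNorm φ (ENNReal.ofReal 2) volume := by
  have hφ : eLpNorm φ (ENNReal.ofReal 2) volume ≠ ∞ :=
    (MemLp.eLpNorm_lt_top (φ.memLp (ENNReal.ofReal 2) volume)).ne
  obtain ⟨B, hB⟩ : ∃ B : ℝ≥0, (B : ℝ≥0∞) = A * eLpNorm φ (ENNReal.ofReal 2) volume :=
    ⟨_, ENNReal.coe_toNNReal (ENNReal.mul_ne_top ENNReal.coe_ne_top hφ)⟩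
  have key : ∫⁻ x, ‖transposeConv K φ x‖ₑ ^ (2 : ℝ) ≤ (B : ℝ≥0∞) ^ (2 : ℝ) := by
    refine lintegral_rpow_le_of_schwartz (h.continuous_transposeConv φ).locallyIntegrable
      Real.HolderConjugate.two_two fun θ _ => ?_
    rw [hB, ← eLpNorm_ofReal_eq (f := θ) (two_pos : (0 : ℝ) < 2)]
    exact h.enorm_integral_transposeConv_mul_le φ θ
  rw [lintegral_rpow_eq_eLpNorm (two_pos : (0 : ℝ) < 2),
    ENNReal.rpow_le_rpow_iff (two_pos : (0 : ℝ) < 2), hB] at key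
  exact key

theorem transposeConv_sub (K : 𝓢'(Rn n, ℂ)) (φ ψ : 𝓢(Rn n, ℂ)) :
    transposeConv K (φ - ψ) = transposeConv K φ - transposeConv K ψ := by
  ext y; simp [transposeConv]

namespace KernelData

variable {K : 𝓢'(Rn n, ℂ)} {k m : Rn n → ℂ} {A c : ℝ≥0}

theorem transposeConv_eq_integral (h : KernelData K k m A c) {φ : 𝓢(Rn n, ℂ)}
    (hφ : HasCompactSupport φ) {y : Rn n} (hy : y ∉ tsupport φ) :
    transposeConv K φ y = ∫ x, k (x - y) * φ x := by
  have e : (φ.compSubConstCLM ℂ (-y) : Rn n → ℂ) = (φ : Rn n → ℂ) ∘ fun x => x + y := by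
    ext x; simp
  have h1 : HasCompactSupport (φ.compSubConstCLM ℂ (-y)) := by
    rw [e]
    exact hφ.comp_homeomorph (Homeomorph.addRight y)
  have h2 : (0 : Rn n) ∉ tsupport (φ.compSubConstCLM ℂ (-y)) := by
    rw [e]
    intro h3
    have := tsupport_comp_subset_preimage φ (f := fun x : Rn n => x + y)
      (continuous_id.add continuous_const) h3
    simp at this
    exact hy this
  rw [transposeConv, h.eq_off_zero _ h1 h2, e,
    ← integral_add_right_eq_self (fun x => k (x - y) * φ x) y]
  simp

theorem measurable_kernel (h : KernelData K k m A c) : Measurable k := by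
  refine measurable_of_continuousOn_compl_singleton 0 fun x hx => ContinuousAt.continuousWithinAt ?_
  have hx0 : 0 < ‖x‖ := norm_pos_iff.2 hx
  rw [ContinuousAt, tendsto_iff_norm_sub_tendsto_zero]
  have h1 : Tendsto (fun z : Rn n => c * ‖x - z‖ / ‖x‖ ^ (n + 1)) (𝓝 x) (𝓝 0) := by
    have : Continuous fun z : Rn n => c * ‖x - z‖ / ‖x‖ ^ (n + 1) := by fun_prop
    simpa using this.tendsto x
  refine squeeze_zero' (Eventually.of_forall fun _ => norm_nonneg _) ?_ h1
  filter_upwards [ball_mem_nhds x (half_pos hx0)] with z hz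
  rw [norm_sub_rev]
  have := h.smooth x (x - z) (by rwa [mem_ball, dist_comm, dist_eq_norm] at hz)
  rwa [sub_sub_cancel] at this

theorem exists_norm_transposeConv_le (h : KernelData K k m A c) {φ : 𝓢(Rn n, ℂ)}
    (hφ : HasCompactSupport φ) :
    ∃ C : ℝ, ∀ y, ‖transposeConv K φ y‖ ≤ C * (1 + ‖y‖) ^ (-(n : ℝ)) := by
  obtain ⟨R, hR⟩ := hφ.isBounded.subset_closedBall (0 : Rn n)
  set ρ := max (2 * R) 1 with hρ
  set M := ∫ ξ, ‖𝓕⁻ (φ : Rn n → ℂ) ξ * m ξ‖ with hM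
  have hM0 : 0 ≤ M := integral_nonneg fun _ => norm_nonneg _
  set I := ∫ x, ‖φ x‖ with hI
  have hI0 : 0 ≤ I := integral_nonneg fun _ => norm_nonneg _
  refine ⟨M * (1 + ρ) ^ n + c * 4 ^ n * I, fun y => ?_⟩
  have hρ1 : 1 ≤ ρ := le_max_right _ _
  rw [Real.rpow_neg (by positivity), Real.rpow_natCast, ← div_eq_mul_inv,
    le_div_iff₀ (by positivity)]
  rcases le_or_gt ‖y‖ ρ with hy | hy
  · calc ‖transposeConv K φ y‖ * (1 + ‖y‖) ^ n ≤ M * (1 + ρ) ^ n := by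
          gcongr
          exact h.norm_transposeConv_le φ y
      _ ≤ _ := le_add_of_nonneg_right (by positivity)
  · have hy0 : 0 < ‖y‖ := by linarith
    have hyR : 2 * R < ‖y‖ := (le_max_left _ _).trans_lt hy
    have hyt : y ∉ tsupport φ := by
      intro h1
      have := hR h1
      rw [mem_closedBall, dist_zero_right] at this
      linarith [norm_nonneg y]
    have hb : ‖transposeConv K φ y‖ ≤ ∫ x, c / (‖y‖ / 2) ^ n * ‖φ x‖ := by
      rw [h.transposeConv_eq_integral hφ hyt]
      refine norm_integral_le_of_norm_le (φ.integrable.norm.const_mul _)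
        (Eventually.of_forall fun x => ?_)
      rw [norm_mul]
      by_cases hx : x ∈ tsupport φ
      · have hx' := hR hx
        rw [mem_closedBall, dist_zero_right] at hx'
        have hxy : ‖y‖ / 2 ≤ ‖x - y‖ := by
          have := norm_sub_norm_le y x
          rw [norm_sub_rev] at this
          linarith
        have hne : x - y ≠ 0 := norm_pos_iff.1 (by linarith)
        gcongr
        refine (h.size _ hne).trans ?_
        gcongr
      · rw [image_eq_zero_of_notMem_tsupport hx]
        simp
    rw [integral_const_mul] at hb
    calc ‖transposeConv K φ y‖ * (1 + ‖y‖) ^ n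
        ≤ (c / (‖y‖ / 2) ^ n * I) * (2 * ‖y‖) ^ n := by
          gcongr
          linarith
      _ = c * 4 ^ n * I := by
          rw [div_pow, mul_pow, show (4 : ℝ) = 2 * 2 by norm_num, mul_pow]
          field_simp
      _ ≤ _ := le_add_of_nonneg_left (by positivity)

theorem memLp_transposeConv (h : KernelData K k m A c) (hn : n ≠ 0) {φ : 𝓢(Rn n, ℂ)}
    (hφ : HasCompactSupport φ) {r : ℝ} (hr : 1 < r) :
    MemLp (transposeConv K φ) (ENNReal.ofReal r) volume := by
  obtain ⟨C, hC⟩ := h.exists_norm_transposeConv_le hφ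
  have hr0 : 0 < r := by linarith
  have hn0 : (0 : ℝ) < n := by positivity
  have h1 : MemLp (fun y : Rn n => (1 + ‖y‖) ^ (-(n : ℝ))) (ENNReal.ofReal r) volume := by
    rw [← integrable_norm_rpow_iff
      (Measurable.aestronglyMeasurable (Measurable.pow_const (by fun_prop) _)) (ENNReal.ofReal_pos.2 hr0).ne'
      ENNReal.ofReal_ne_top, ENNReal.toReal_ofReal hr0.le]
    have h2 := integrable_one_add_norm (E := Rn n) (μ := volume) (r := n * r)
      (by rw [finrank_euclideanSpace_fin]; nlinarith)
    refine h2.congr (Eventually.of_forall fun y => ?_)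
    have : (0 : ℝ) < 1 + ‖y‖ := by positivity
    simp only
    rw [Real.norm_of_nonneg (by positivity), ← Real.rpow_mul this.le, neg_mul]
  refine (h1.const_mul C).of_le (h.continuous_transposeConv φ).aestronglyMeasurable
    (Eventually.of_forall fun y => (hC y).trans (Real.le_norm_self _))

theorem isConvolution_reflect_transposeConv (h : KernelData K k m A c) {θ : 𝓢(Rn n, ℂ)}
    (hθ : HasCompactSupport θ) : IsConvolution (VarLp.reflect K) θ (transposeConv K θ) := by
  refine ⟨(h.continuous_transposeConv θ).locallyIntegrable, fun φ _ => ⟨?_, ?_⟩⟩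
  · exact (θ.continuous.mul (h.reflect.continuous_transposeConv φ)).integrable_of_hasCompactSupport
      hθ.mul_right
  · exact h.integral_transposeConv_mul θ φ

/-- If convolution with `K` is bounded on test functions for the norm of `L^q`, it extends to
`L^q`. -/
theorem exists_isConvolution (h : KernelData K k m A c) (hn : n ≠ 0) {q : ℝ} (hq : 1 < q)
    {C : ℝ≥0} (H : ∀ θ : 𝓢(Rn n, ℂ), HasCompactSupport θ →
      eLpNorm (transposeConv (VarLp.reflect K) θ) (ENNReal.ofReal q) volume ≤
        C * eLpNorm θ (ENNReal.ofReal q) volume)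
    {f : Rn n → ℂ} (hf : MemLp f (ENNReal.ofReal q) volume) :
    ∃ g, IsConvolution K f g ∧ MemLp g (ENNReal.ofReal q) volume ∧
      eLpNorm g (ENNReal.ofReal q) volume ≤ C * eLpNorm f (ENNReal.ofReal q) volume := by
  set p := ENNReal.ofReal q with hp
  have hp1 : 1 ≤ p := by rw [hp, ENNReal.one_le_ofReal]; exact hq.le
  have : Fact (1 ≤ p) := ⟨hp1⟩
  obtain ⟨r, hqr⟩ : ∃ r, q.HolderConjugate r := ⟨_, Real.HolderConjugate.conjExponent hq⟩
  have hr : 1 < r := hqr.symm.lt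
  have hε : ∀ j : ℕ, (0 : ℝ) < 1 / ((j : ℝ) + 1) := fun j => by positivity
  choose φ' hφc hφd hφ using fun j : ℕ => hf.exist_eLpNorm_sub_le ENNReal.ofReal_ne_top hp1 (hε j)
  let φ : ℕ → 𝓢(Rn n, ℂ) := fun j => (hφc j).toSchwartzMap (hφd j)
  have hφL : ∀ j, MemLp (φ j) p volume := fun j => (φ j).memLp p volume
  let u : ℕ → Rn n → ℂ := fun j => transposeConv (VarLp.reflect K) (φ j)
  have hu : ∀ j, MemLp (u j) p volume := fun j => h.reflect.memLp_transposeConv hn (hφc j) hq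
  have hφ0 : Tendsto (fun j => eLpNorm ((φ j : Rn n → ℂ) - f) p volume) atTop (𝓝 0) := by
    have h1 : Tendsto (fun j : ℕ => ENNReal.ofReal (1 / ((j : ℝ) + 1))) atTop (𝓝 0) := by
      simpa using ENNReal.tendsto_ofReal tendsto_one_div_add_atTop_nhds_zero_nat
    refine tendsto_of_tendsto_of_tendsto_of_le_of_le tendsto_const_nhds h1 (fun _ => zero_le)
      fun j => ?_
    simp only
    rw [eLpNorm_sub_comm]
    exact hφ j
  have hdiff : ∀ i j, eLpNorm (u i - u j) p volume ≤
      C * (eLpNorm ((φ i : Rn n → ℂ) - f) p volume + eLpNorm ((φ j : Rn n → ℂ) - f) p volume) := by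
    intro i j
    have h1 := H (φ i - φ j) ((hφc i).sub (hφc j))
    rw [transposeConv_sub] at h1
    refine h1.trans ?_
    gcongr
    have e : ((φ i - φ j : 𝓢(Rn n, ℂ)) : Rn n → ℂ) = (φ i - f) - (φ j - f) := by
      ext x; simp
    rw [e]
    exact eLpNorm_sub_le ((hφL i).1.sub hf.1) ((hφL j).1.sub hf.1) hp1
  let U : ℕ → Lp ℂ p (volume : Measure (Rn n)) := fun j => (hu j).toLp
  have hcau : CauchySeq U := by
    rw [EMetric.cauchySeq_iff]
    intro ε hε
    have h2 : Tendsto (fun j => C * eLpNorm ((φ j : Rn n → ℂ) - f) p volume) atTop (𝓝 0) := by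
      simpa using ENNReal.Tendsto.const_mul hφ0 (Or.inr ENNReal.coe_ne_top)
    obtain ⟨N, hN⟩ := eventually_atTop.1 (h2.eventually (gt_mem_nhds (ENNReal.half_pos hε.ne')))
    refine ⟨N, fun i hi j hj => ?_⟩
    rw [Lp.edist_toLp_toLp]
    refine (hdiff i j).trans_lt ?_
    rw [mul_add, ← ENNReal.add_halves ε]
    exact ENNReal.add_lt_add (hN i hi) (hN j hj)
  obtain ⟨g, hgL, hug⟩ : ∃ g : Rn n → ℂ, MemLp g p volume ∧
      Tendsto (fun j => eLpNorm (u j - g) p volume) atTop (𝓝 0) := by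
    obtain ⟨G, hG⟩ := cauchySeq_tendsto_of_complete hcau
    refine ⟨⇑G, Lp.memLp G, ?_⟩
    rw [Lp.tendsto_Lp_iff_tendsto_eLpNorm'] at hG
    refine hG.congr fun j => eLpNorm_congr_ae ?_
    exact (hu j).coeFn_toLp.sub (ae_eq_refl _)
  refine ⟨g, ⟨hgL.locallyIntegrable hp1, fun θ hθ => ⟨?_, ?_⟩⟩, hgL, ?_⟩
  · have : ENNReal.HolderConjugate p (ENNReal.ofReal r) := hqr.ennrealOfReal
    exact hf.integrable_mul (h.memLp_transposeConv hn hθ hr)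
  · have l1 := tendsto_integral_mul_of_tendsto_eLpNorm hqr hu hgL
      (θ.memLp (ENNReal.ofReal r) volume) hug
    have l2 := tendsto_integral_mul_of_tendsto_eLpNorm hqr hφL hf
      (h.memLp_transposeConv hn hθ hr) hφ0
    refine tendsto_nhds_unique l1 (l2.congr fun j => ?_)
    have := h.integral_transposeConv_mul θ (φ j)
    simp_rw [mul_comm (φ j _), this, mul_comm (θ _)]
    rfl
  · have l1 : Tendsto (fun j => eLpNorm (u j - g) p volume + C *
        (eLpNorm f p volume + eLpNorm ((φ j : Rn n → ℂ) - f) p volume)) atTop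
        (𝓝 (0 + C * (eLpNorm f p volume + 0))) :=
      hug.add (ENNReal.Tendsto.const_mul (hφ0.const_add _) (Or.inr ENNReal.coe_ne_top))
    rw [zero_add, add_zero] at l1
    refine ge_of_tendsto' l1 fun j => ?_
    have e1 : g = u j - (u j - g) := by simp
    have e2 : (φ j : Rn n → ℂ) = f + (φ j - f) := by simp
    calc eLpNorm g p volume ≤ eLpNorm (u j) p volume + eLpNorm (u j - g) p volume := by
          nth_rewrite 1 [e1]
          exact eLpNorm_sub_le (hu j).1 ((hu j).1.sub hgL.1) hp1
      _ ≤ C * (eLpNorm f p volume + eLpNorm ((φ j : Rn n → ℂ) - f) p volume) +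
          eLpNorm (u j - g) p volume := by
          gcongr
          refine (H (φ j) (hφc j)).trans ?_
          gcongr
          nth_rewrite 1 [e2]
          exact eLpNorm_add_le hf.1 ((hφL j).1.sub hf.1) hp1
      _ = _ := add_comm _ _

end KernelData

namespace IsConvolution

variable {K : 𝓢'(Rn n, ℂ)} {f f' g g' : Rn n → ℂ}

theorem add (h : IsConvolution K f g) (h' : IsConvolution K f' g') :
    IsConvolution K (fun x => f x + f' x) (fun x => g x + g' x) := by
  refine ⟨h.1.add h'.1, fun φ hφ => ⟨?_, ?_⟩⟩
  · simp_rw [add_mul]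
    exact (h.2 φ hφ).1.add (h'.2 φ hφ).1
  · simp_rw [add_mul]
    rw [integral_add (integrable_mul_of_locallyIntegrable h.1 φ.continuous hφ)
      (integrable_mul_of_locallyIntegrable h'.1 φ.continuous hφ),
      integral_add (h.2 φ hφ).1 (h'.2 φ hφ).1, (h.2 φ hφ).2, (h'.2 φ hφ).2]

theorem const_mul (h : IsConvolution K f g) (a : ℂ) :
    IsConvolution K (fun x => a * f x) (fun x => a * g x) := by
  refine ⟨h.1.smul a, fun φ hφ => ⟨?_, ?_⟩⟩
  · simp_rw [mul_assoc]
    exact (h.2 φ hφ).1.const_mul a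
  · simp_rw [mul_assoc]
    rw [integral_const_mul, integral_const_mul, (h.2 φ hφ).2]

theorem zero (K : 𝓢'(Rn n, ℂ)) : IsConvolution K (fun _ => 0) (fun _ => 0) :=
  ⟨locallyIntegrable_zero, fun φ hφ => by simp⟩

theorem sum {ι : Type*} (s : Finset ι) {F G : ι → Rn n → ℂ}
    (h : ∀ i ∈ s, IsConvolution K (F i) (G i)) :
    IsConvolution K (fun x => ∑ i ∈ s, F i x) (fun x => ∑ i ∈ s, G i x) := by
  classical
  induction s using Finset.induction_on with
  | empty => simpa using zero K
  | insert a s ha ih =>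
    simp_rw [Finset.sum_insert ha]
    exact (h a (Finset.mem_insert_self _ _)).add
      (ih fun i hi => h i (Finset.mem_insert_of_mem hi))

theorem unique (h : IsConvolution K f g) (h' : IsConvolution K f g') : g =ᵐ[volume] g' :=
  ae_eq_of_forall_integral_mul_eq h.1 h'.1 fun φ hφ => by rw [(h.2 φ hφ).2, (h'.2 φ hφ).2]

theorem congr_left (h : IsConvolution K f g) (hf : f =ᵐ[volume] f') : IsConvolution K f' g := by
  refine ⟨h.1, fun φ hφ => ?_⟩
  have e : (fun y => f y * transposeConv K φ y) =ᵐ[volume] fun y => f' y * transposeConv K φ y :=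
    hf.mono fun x hx => by simp only [hx]
  exact ⟨(h.2 φ hφ).1.congr e, by rw [(h.2 φ hφ).2, integral_congr_ae e]⟩

end IsConvolution

namespace KernelData

variable {K : 𝓢'(Rn n, ℂ)} {k m : Rn n → ℂ} {A c : ℝ≥0}

theorem norm_kernel_mul_le (h : KernelData K k m A c) {f : Rn n → ℂ} {a : Rn n} {r δ : ℝ}
    (hf : ∀ y, y ∉ closedBall a r → f y = 0) (hδ : 0 < δ) {x : Rn n} (hx : δ ≤ dist x a - r)
    (y : Rn n) : ‖k (x - y) * f y‖ ≤ c / δ ^ n * ‖f y‖ := by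
  rw [norm_mul]
  by_cases hy : y ∈ closedBall a r
  · have h1 : δ ≤ ‖x - y‖ := by
      rw [← dist_eq_norm]
      have := dist_triangle x y a
      rw [mem_closedBall] at hy
      linarith
    have : x - y ≠ 0 := norm_pos_iff.1 (by linarith)
    gcongr
    refine (h.size _ this).trans ?_
    gcongr
  · simp [hf y hy]

theorem integrable_kernel_mul (h : KernelData K k m A c) {f : Rn n → ℂ}
    (hfi : Integrable f volume) {a : Rn n} {r : ℝ} (hf : ∀ y, y ∉ closedBall a r → f y = 0)
    {x : Rn n} (hx : x ∉ closedBall a r) : Integrable (fun y => k (x - y) * f y) volume := by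
  rw [mem_closedBall, not_le, ← sub_pos] at hx
  refine Integrable.mono' (hfi.norm.const_mul (c / (dist x a - r) ^ n)) ?_
    (Eventually.of_forall (h.norm_kernel_mul_le hf hx le_rfl))
  exact (h.measurable_kernel.comp (measurable_const.sub measurable_id)).aestronglyMeasurable.mul
    hfi.1

/-- Off the support of `f`, the convolution with `K` is the integral against the kernel. -/
theorem ae_eq_integral (h : KernelData K k m A c) {f g : Rn n → ℂ} (hfg : IsConvolution K f g)
    (hfi : Integrable f volume) {a : Rn n} {r : ℝ} (hf : ∀ y, y ∉ closedBall a r → f y = 0) :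
    ∀ᵐ x ∂(volume : Measure (Rn n)), x ∈ (closedBall a r)ᶜ → g x = ∫ y, k (x - y) * f y := by
  have hprod : AEStronglyMeasurable (fun p : Rn n × Rn n => k (p.1 - p.2) * f p.2)
      (volume.prod volume) :=
    (h.measurable_kernel.comp (measurable_fst.sub measurable_snd)).aestronglyMeasurable.mul
      hfi.1.comp_snd
  have hGm : AEStronglyMeasurable (fun x => ∫ y, k (x - y) * f y) volume :=
    hprod.integral_prod_right'
  have hU : IsOpen (closedBall a r)ᶜ := isClosed_closedBall.isOpen_compl
  have hδ : ∀ S : Set (Rn n), IsCompact S → S ⊆ (closedBall a r)ᶜ →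
      ∃ δ : ℝ, 0 < δ ∧ ∀ x ∈ S, δ ≤ dist x a - r := by
    intro S hS hSU
    refine hS.exists_forall_le' (f := fun x => dist x a - r) (by fun_prop) fun x hx => ?_
    have := hSU hx
    rw [mem_compl_iff, mem_closedBall, not_le] at this
    linarith
  refine ae_eq_on_of_forall_integral_mul_eq hU (hfg.1.locallyIntegrableOn _) ?_ ?_
  · rw [locallyIntegrableOn_iff hU.isLocallyClosed]
    intro S hSU hS
    obtain ⟨δ, hδ0, hδS⟩ := hδ S hS hSU
    refine Measure.integrableOn_of_bounded (M := ∫ y, c / δ ^ n * ‖f y‖) hS.measure_lt_top.ne hGm ?_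
    filter_upwards [ae_restrict_mem hS.measurableSet] with x hx
    exact norm_integral_le_of_norm_le (hfi.norm.const_mul _)
      (Eventually.of_forall (h.norm_kernel_mul_le hf hδ0 (hδS x hx)))
  · intro φ hφ hφU
    obtain ⟨δ, hδ0, hδS⟩ := hδ _ hφ hφU
    have hint : Integrable (fun p : Rn n × Rn n => k (p.1 - p.2) * f p.2 * φ p.1)
        (volume.prod volume) := by
      refine Integrable.mono' ((φ.integrable.norm.mul_prod hfi.norm).const_mul (c / δ ^ n))
        (hprod.mul φ.continuous.aestronglyMeasurable.comp_fst) (Eventually.of_forall fun p => ?_)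
      rw [norm_mul]
      by_cases hp : p.1 ∈ tsupport φ
      · calc _ ≤ c / δ ^ n * ‖f p.2‖ * ‖φ p.1‖ := by
              gcongr
              exact h.norm_kernel_mul_le hf hδ0 (hδS _ hp) _
          _ = _ := by ring
      · simp [image_eq_zero_of_notMem_tsupport hp]
    rw [(hfg.2 φ hφ).2]
    calc ∫ y, f y * transposeConv K φ y = ∫ y, ∫ x, k (x - y) * f y * φ x := by
          refine integral_congr_ae (Eventually.of_forall fun y => ?_)
          simp only
          by_cases hy : y ∈ closedBall a r
          · rw [h.transposeConv_eq_integral hφ (fun hy' => hφU hy' hy), ← integral_const_mul]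
            congr 1; ext x; ring
          · simp [hf y hy]
      _ = ∫ x, ∫ y, k (x - y) * f y * φ x := (integral_integral_swap hint).symm
      _ = _ := by simp_rw [integral_mul_const]

end KernelData

/-- The scale invariant bound for the tail integral of `|x|⁻ⁿ⁻¹`. -/
theorem exists_lintegral_tail_le (n : ℕ) : ∃ D : ℝ≥0, ∀ (a : Rn n) (r : ℝ), 0 < r →
    ∫⁻ x in (closedBall a (2 * r))ᶜ, ENNReal.ofReal (r / ‖x - a‖ ^ (n + 1)) ≤ D := by
  let F : Rn n → ℝ≥0∞ := (closedBall (0 : Rn n) 2)ᶜ.indicator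
    fun x => ENNReal.ofReal (1 / ‖x‖ ^ (n + 1))
  have hF : ∫⁻ x, F x < ∞ := by
    have h1 := (integrable_one_add_norm (E := Rn n) (μ := volume) (r := n + 1)
      (by rw [finrank_euclideanSpace_fin]; linarith)).const_mul (2 ^ (n + 1))
    refine lt_of_le_of_lt (lintegral_mono fun x => ?_) h1.lintegral_lt_top
    by_cases hx : x ∈ (closedBall (0 : Rn n) 2)ᶜ
    · simp only [F, indicator_of_mem hx]
      refine ENNReal.ofReal_le_ofReal ?_
      have hx2 : 2 < ‖x‖ := by simpa using hx
      have e : (1 + ‖x‖) ^ (-((n : ℝ) + 1)) = ((1 + ‖x‖) ^ (n + 1))⁻¹ := by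
        rw [Real.rpow_neg (by positivity), ← Nat.cast_add_one, Real.rpow_natCast]
      rw [e, ← div_eq_mul_inv, div_le_div_iff₀ (by positivity) (by positivity), one_mul, ← mul_pow]
      gcongr
      linarith
    · simp only [F, indicator_of_notMem hx]
      exact zero_le
  refine ⟨(∫⁻ x, F x).toNNReal, fun a r hr => ?_⟩
  rw [ENNReal.coe_toNNReal hF.ne, ← lintegral_indicator isClosed_closedBall.measurableSet.compl]
  have e : ∀ x, (closedBall a (2 * r))ᶜ.indicator
      (fun x => ENNReal.ofReal (r / ‖x - a‖ ^ (n + 1))) x =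
      ENNReal.ofReal ((r ^ n)⁻¹) * F (r⁻¹ • (x - a)) := by
    intro x
    have hmem : r⁻¹ • (x - a) ∈ (closedBall (0 : Rn n) 2)ᶜ ↔ x ∈ (closedBall a (2 * r))ᶜ := by
      rw [mem_compl_iff, mem_compl_iff, mem_closedBall, mem_closedBall, dist_zero_right, norm_smul,
        norm_inv, Real.norm_of_nonneg hr.le, dist_eq_norm, inv_mul_le_iff₀ hr, mul_comm r]
    by_cases hx : x ∈ (closedBall a (2 * r))ᶜ
    · simp only [F, indicator_of_mem hx, indicator_of_mem (hmem.2 hx)]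
      rw [← ENNReal.ofReal_mul (by positivity), norm_smul, norm_inv, Real.norm_of_nonneg hr.le]
      congr 1
      have : 0 < ‖x - a‖ := by
        rw [mem_compl_iff, mem_closedBall, not_le, dist_eq_norm] at hx
        linarith
      rw [mul_pow, inv_pow, pow_succ r]
      field_simp
    · simp only [F, indicator_of_notMem hx, indicator_of_notMem (fun h => hx (hmem.1 h)), mul_zero]
  simp_rw [e]
  rw [lintegral_const_mul' _ _ ENNReal.ofReal_ne_top,
    lintegral_sub_right_eq_self (fun x => F (r⁻¹ • x)) a]
  have hFm : Measurable F := Measurable.indicator (by fun_prop)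
    isClosed_closedBall.measurableSet.compl
  have h2 := lintegral_map (μ := (volume : Measure (Rn n))) hFm
    (measurable_const_smul (r⁻¹ : ℝ))
  rw [Measure.map_addHaar_smul _ (inv_ne_zero hr.ne'), lintegral_smul_measure,
    finrank_euclideanSpace_fin] at h2
  rw [← h2, smul_eq_mul, ← mul_assoc, ← ENNReal.ofReal_mul (by positivity), inv_pow, inv_inv,
    abs_of_pos (by positivity), inv_mul_cancel₀ (by positivity), ENNReal.ofReal_one, one_mul]

theorem KernelData.lintegral_compl_le_of_integral_eq_zero {K : 𝓢'(Rn n, ℂ)} {k m : Rn n → ℂ}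
    {A c : ℝ≥0} (h : KernelData K k m A c) {D : ℝ≥0}
    (hD : ∀ (a : Rn n) (r : ℝ), 0 < r →
      ∫⁻ x in (closedBall a (2 * r))ᶜ, ENNReal.ofReal (r / ‖x - a‖ ^ (n + 1)) ≤ D)
    {b g : Rn n → ℂ} (hbg : IsConvolution K b g)
    (hbi : Integrable b volume) (hb0 : ∫ y, b y = 0) {a : Rn n} {r : ℝ} (hr : 0 < r)
    (hb : ∀ y, y ∉ closedBall a r → b y = 0) :
    ∫⁻ x in (closedBall a (2 * r))ᶜ, ‖g x‖ₑ ≤ c * D * ∫⁻ y, ‖b y‖ₑ := by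
  have hpt : ∀ᵐ x ∂(volume : Measure (Rn n)), x ∈ (closedBall a (2 * r))ᶜ →
      ‖g x‖ₑ ≤ (c * ∫⁻ y, ‖b y‖ₑ) * ENNReal.ofReal (r / ‖x - a‖ ^ (n + 1)) := by
    filter_upwards [h.ae_eq_integral hbg hbi hb] with x hx hxa
    have hxr : x ∉ closedBall a r := fun hx' => hxa (closedBall_subset_closedBall (by linarith) hx')
    have hxn : 2 * r < ‖x - a‖ := by
      rw [mem_compl_iff, mem_closedBall, not_le, dist_eq_norm] at hxa
      exact hxa
    have e : g x = ∫ y, (k (x - y) - k (x - a)) * b y := by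
      simp_rw [sub_mul]
      rw [integral_sub (h.integrable_kernel_mul hbi hb hxr) (hbi.const_mul _), integral_const_mul,
        hb0, mul_zero, sub_zero]
      exact hx hxr
    rw [e]
    calc ‖∫ y, (k (x - y) - k (x - a)) * b y‖ₑ ≤ ∫⁻ y, ‖(k (x - y) - k (x - a)) * b y‖ₑ :=
          enorm_integral_le_lintegral_enorm _
      _ ≤ ∫⁻ y, ENNReal.ofReal (c * r / ‖x - a‖ ^ (n + 1)) * ‖b y‖ₑ := by
          refine lintegral_mono fun y => ?_
          rw [enorm_mul]
          by_cases hy : y ∈ closedBall a r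
          · gcongr
            rw [← ofReal_norm]
            refine ENNReal.ofReal_le_ofReal ?_
            rw [mem_closedBall, dist_eq_norm] at hy
            have := h.smooth (x - a) (y - a) (by linarith)
            rw [sub_sub_sub_cancel_right, norm_sub_rev] at this
            refine this.trans ?_
            gcongr
          · simp [hb y hy]
      _ = ENNReal.ofReal (c * r / ‖x - a‖ ^ (n + 1)) * ∫⁻ y, ‖b y‖ₑ :=
          lintegral_const_mul' _ _ ENNReal.ofReal_ne_top
      _ = _ := by
          rw [mul_div_assoc, ENNReal.ofReal_mul (by positivity), ENNReal.ofReal_coe_nnreal]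
          ring
  calc ∫⁻ x in (closedBall a (2 * r))ᶜ, ‖g x‖ₑ
      ≤ ∫⁻ x in (closedBall a (2 * r))ᶜ,
          (c * ∫⁻ y, ‖b y‖ₑ) * ENNReal.ofReal (r / ‖x - a‖ ^ (n + 1)) :=
        lintegral_mono_ae ((ae_restrict_iff' isClosed_closedBall.measurableSet.compl).2 hpt)
    _ = (c * ∫⁻ y, ‖b y‖ₑ) *
          ∫⁻ x in (closedBall a (2 * r))ᶜ, ENNReal.ofReal (r / ‖x - a‖ ^ (n + 1)) :=
        lintegral_const_mul' _ _ (ENNReal.mul_ne_top ENNReal.coe_ne_top hbi.2.ne)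
    _ ≤ (c * ∫⁻ y, ‖b y‖ₑ) * D := by gcongr; exact hD a r hr
    _ = _ := by ring

theorem dyadicCube_nonempty (j : ℤ × (Fin n → ℤ)) : (dyadicCube j).Nonempty := by
  by_contra h
  exact volume_dyadicCube_ne_zero j (by rw [not_nonempty_iff_eq_empty.1 h, measure_empty])

theorem enorm_average_mul_le (f : Rn n → ℂ) (j : ℤ × (Fin n → ℤ)) :
    ‖⨍ y in dyadicCube j, f y‖ₑ * volume (dyadicCube j) ≤ ∫⁻ y in dyadicCube j, ‖f y‖ₑ := by
  have h0 := volume_dyadicCube_ne_zero j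
  have ht := volume_dyadicCube_ne_top j
  have hpos : 0 < volume.real (dyadicCube j) := ENNReal.toReal_pos h0 ht
  rw [setAverage_eq, enorm_smul, ← ofReal_norm, norm_inv, Real.norm_of_nonneg hpos.le,
    ENNReal.ofReal_inv_of_pos hpos, measureReal_def, ENNReal.ofReal_toReal ht, mul_right_comm,
    ENNReal.inv_mul_cancel h0 ht, one_mul]
  exact enorm_integral_le_lintegral_enorm _

theorem KernelData.exists_isConvolution_two {K : 𝓢'(Rn n, ℂ)} {k m : Rn n → ℂ} {A c : ℝ≥0}
    (h : KernelData K k m A c) (hn : n ≠ 0) {f : Rn n → ℂ} (hf : MemLp f 2 volume) :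
    ∃ g, IsConvolution K f g ∧ ∫⁻ x, ‖g x‖ₑ ^ 2 ≤ A ^ 2 * ∫⁻ x, ‖f x‖ₑ ^ 2 := by
  obtain ⟨g, hg, -, hgb⟩ := h.exists_isConvolution hn one_lt_two
    (fun θ _ => h.reflect.eLpNorm_two_transposeConv_le θ) (f := f) (by simpa using hf)
  rw [eLpNorm_le_mul_iff two_pos] at hgb
  exact ⟨g, hg, by simpa using hgb⟩

/-- The part of `f` with mean zero on a dyadic cube. -/
noncomputable def badPart (f : Rn n → ℂ) (j : ℤ × (Fin n → ℤ)) : Rn n → ℂ :=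
  (dyadicCube j).indicator fun y => f y - ⨍ z in dyadicCube j, f z

theorem integrableOn_sub_average {f : Rn n → ℂ} (hf : Integrable f volume)
    (j : ℤ × (Fin n → ℤ)) :
    IntegrableOn (fun y => f y - ⨍ z in dyadicCube j, f z) (dyadicCube j) volume :=
  hf.integrableOn.sub (integrableOn_const (volume_dyadicCube_ne_top j))

theorem integrable_badPart {f : Rn n → ℂ} (hf : Integrable f volume)
    (j : ℤ × (Fin n → ℤ)) : Integrable (badPart f j) volume :=
  (integrable_indicator_iff (measurableSet_dyadicCube j)).2 (integrableOn_sub_average hf j)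

theorem integral_badPart {f : Rn n → ℂ} (hf : Integrable f volume)
    (j : ℤ × (Fin n → ℤ)) : ∫ y, badPart f j y = 0 := by
  have hpos : 0 < volume.real (dyadicCube j) :=
    ENNReal.toReal_pos (volume_dyadicCube_ne_zero j) (volume_dyadicCube_ne_top j)
  unfold badPart
  rw [integral_indicator (measurableSet_dyadicCube j), integral_sub hf.integrableOn
    (integrableOn_const (volume_dyadicCube_ne_top j)), setIntegral_const, setAverage_eq, smul_smul,
    mul_inv_cancel₀ hpos.ne', one_smul, sub_self]

theorem lintegral_badPart_le {f : Rn n → ℂ} (hf : Integrable f volume)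
    (j : ℤ × (Fin n → ℤ)) :
    ∫⁻ y, ‖badPart f j y‖ₑ ≤ 2 * ∫⁻ y in dyadicCube j, ‖f y‖ₑ := by
  unfold badPart
  simp_rw [enorm_indicator_eq_indicator_enorm]
  rw [lintegral_indicator (measurableSet_dyadicCube j), two_mul]
  calc ∫⁻ y in dyadicCube j, ‖f y - ⨍ z in dyadicCube j, f z‖ₑ
      ≤ ∫⁻ y in dyadicCube j, (‖f y‖ₑ + ‖⨍ z in dyadicCube j, f z‖ₑ) :=
        lintegral_mono fun y => enorm_sub_le
    _ = (∫⁻ y in dyadicCube j, ‖f y‖ₑ) +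
          ‖⨍ z in dyadicCube j, f z‖ₑ * volume (dyadicCube j) := by
        rw [lintegral_add_left' hf.1.enorm.restrict, setLIntegral_const]
    _ ≤ _ := by gcongr; exact enorm_average_mul_le f j

theorem memLp_badPart {f : Rn n → ℂ} (hf2 : MemLp f 2 volume) (j : ℤ × (Fin n → ℤ)) :
    MemLp (badPart f j) 2 volume := by
  rw [badPart, memLp_indicator_iff_restrict (measurableSet_dyadicCube j)]
  have : IsFiniteMeasure (volume.restrict (dyadicCube j)) :=
    ⟨by rw [Measure.restrict_apply_univ]; exact (volume_dyadicCube_ne_top j).lt_top⟩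
  exact (hf2.restrict _).sub (memLp_const _)

theorem lintegral_goodPart_sq_le {f : Rn n → ℂ} {t : ℝ≥0∞}
    {F : Finset (ℤ × (Fin n → ℤ))}
    (hdisj : (F : Set (ℤ × (Fin n → ℤ))).PairwiseDisjoint dyadicCube)
    (hlow : ∀ j ∈ F, t * volume (dyadicCube j) ≤ ∫⁻ y in dyadicCube j, ‖f y‖ₑ)
    (hupp : ∀ j ∈ F, ∫⁻ y in dyadicCube j, ‖f y‖ₑ ≤ 2 ^ n * t * volume (dyadicCube j))
    (hout : ∫⁻ x in (⋃ j ∈ F, dyadicCube j)ᶜ, ‖f x‖ₑ ^ 2 ≤ 2 * t * ∫⁻ x, ‖f x‖ₑ) :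
    ∫⁻ x, ‖f x - ∑ j ∈ F, badPart f j x‖ₑ ^ 2 ≤ (2 + 4 ^ n) * t * ∫⁻ x, ‖f x‖ₑ := by
  set Ω := ⋃ j ∈ F, dyadicCube j with hΩ
  have hΩm : MeasurableSet Ω := F.measurableSet_biUnion fun j _ => measurableSet_dyadicCube j
  have havg : ∀ j ∈ F, ‖⨍ z in dyadicCube j, f z‖ₑ ≤ 2 ^ n * t := by
    intro j hj
    have := (enorm_average_mul_le f j).trans (hupp j hj)
    exact (ENNReal.mul_le_mul_iff_left (volume_dyadicCube_ne_zero j)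
      (volume_dyadicCube_ne_top j)).1 this
  have hin : ∀ i ∈ F, ∀ x ∈ dyadicCube i,
      f x - ∑ j ∈ F, badPart f j x = ⨍ z in dyadicCube i, f z := by
    intro i hi x hx
    rw [Finset.sum_eq_single_of_mem i hi, badPart, indicator_of_mem hx, sub_sub_cancel]
    intro j hj hji
    exact indicator_of_notMem (fun hxj => disjoint_left.1 (hdisj hj hi hji) hxj hx) _
  have hnot : ∀ x ∈ Ωᶜ, f x - ∑ j ∈ F, badPart f j x = f x := by
    intro x hx
    rw [Finset.sum_eq_zero, sub_zero]
    intro j hj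
    exact indicator_of_notMem (fun hxj => hx (mem_iUnion₂.2 ⟨j, hj, hxj⟩)) _
  rw [← lintegral_add_compl _ hΩm, hΩ,
    lintegral_biUnion_finset hdisj fun j _ => measurableSet_dyadicCube j, ← hΩ]
  have h1 : ∑ j ∈ F, ∫⁻ x in dyadicCube j, ‖f x - ∑ j ∈ F, badPart f j x‖ₑ ^ 2 ≤
      4 ^ n * t * ∫⁻ x, ‖f x‖ₑ := by
    calc _ ≤ ∑ j ∈ F, 4 ^ n * t * ∫⁻ x in dyadicCube j, ‖f x‖ₑ := by
          refine Finset.sum_le_sum fun j hj => ?_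
          calc ∫⁻ x in dyadicCube j, ‖f x - ∑ j ∈ F, badPart f j x‖ₑ ^ 2
              ≤ ∫⁻ _ in dyadicCube j, (2 ^ n * t) ^ 2 := by
                refine setLIntegral_mono' (measurableSet_dyadicCube j) fun x hx => ?_
                rw [hin j hj x hx]
                gcongr
                exact havg j hj
            _ = 4 ^ n * t * (t * volume (dyadicCube j)) := by
                rw [setLIntegral_const, mul_pow, ← pow_mul, mul_comm n 2, pow_mul]
                norm_num
                ring
            _ ≤ _ := by gcongr; exact hlow j hj
      _ = 4 ^ n * t * ∫⁻ x in Ω, ‖f x‖ₑ := by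
          rw [← Finset.mul_sum, hΩ,
            lintegral_biUnion_finset hdisj fun j _ => measurableSet_dyadicCube j]
      _ ≤ _ := by gcongr; exact Measure.restrict_le_self
  have h2 : ∫⁻ x in Ωᶜ, ‖f x - ∑ j ∈ F, badPart f j x‖ₑ ^ 2 ≤ 2 * t * ∫⁻ x, ‖f x‖ₑ := by
    refine le_trans (setLIntegral_mono' hΩm.compl fun x hx => ?_) hout
    rw [hnot x hx]
  calc _ ≤ 4 ^ n * t * (∫⁻ x, ‖f x‖ₑ) + 2 * t * ∫⁻ x, ‖f x‖ₑ := add_le_add h1 h2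
    _ = _ := by ring

/-- Convolution with a Calderón–Zygmund kernel is of weak type `(1,1)`. -/
theorem KernelData.exists_weakType_one {K : 𝓢'(Rn n, ℂ)} {k m : Rn n → ℂ} {A c : ℝ≥0}
    (h : KernelData K k m A c) (hn : n ≠ 0) :
    ∃ C : ℝ≥0, ∀ f g : Rn n → ℂ, Integrable f volume → MemLp f 2 volume → IsConvolution K f g →
      ∀ t : ℝ≥0∞, t ≠ 0 → t ≠ ∞ → t * volume {x | t < ‖g x‖ₑ} ≤ C * ∫⁻ x, ‖f x‖ₑ := by
  obtain ⟨D, hD⟩ := exists_lintegral_tail_le n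
  refine ⟨2 ^ n * ballCubeRatio n + 4 * A ^ 2 * (2 + 4 ^ n) + 4 * c * D,
    fun f g hf hf2 hfg t ht0 htt => ?_⟩
  obtain ⟨F, hdisj, hlow, hupp, hout⟩ := exists_calderonZygmund_cubes hn hf hf2 ht0
  set I := ∫⁻ x, ‖f x‖ₑ with hI
  have hsumI : ∑ j ∈ F, ∫⁻ y in dyadicCube j, ‖f y‖ₑ ≤ I := by
    rw [← lintegral_biUnion_finset hdisj fun j _ => measurableSet_dyadicCube j]
    exact setLIntegral_le_lintegral _ _
  have hbad : ∀ j, ∃ G, IsConvolution K (badPart f j) G := fun j =>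
    (h.exists_isConvolution_two hn (memLp_badPart hf2 j)).imp fun _ h => h.1
  choose G hG using hbad
  have hgood2 : MemLp (fun x => f x - ∑ j ∈ F, badPart f j x) 2 volume :=
    hf2.sub (memLp_finsetSum F fun j _ => memLp_badPart hf2 j)
  obtain ⟨g0, hg0, hg0b⟩ := h.exists_isConvolution_two hn hgood2
  have hgeq : g =ᵐ[volume] fun x => g0 x + ∑ j ∈ F, G j x := by
    refine hfg.unique ((hg0.add (IsConvolution.sum F fun j _ => hG j)).congr_left ?_)
    exact Eventually.of_forall fun x => by simp
  choose a ha using fun j : ℤ × (Fin n → ℤ) => dyadicCube_nonempty j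
  let B := ⋃ j ∈ F, closedBall (a j) (2 * dyadicRadius n j.1)
  have hBm : MeasurableSet B := F.measurableSet_biUnion fun j _ => measurableSet_closedBall
  have hB : t * volume B ≤ 2 ^ n * ballCubeRatio n * I := by
    calc t * volume B ≤ t * ∑ j ∈ F, volume (closedBall (a j) (2 * dyadicRadius n j.1)) := by
          gcongr
          exact measure_biUnion_finset_le _ _
      _ = 2 ^ n * ballCubeRatio n * ∑ j ∈ F, t * volume (dyadicCube j) := by
          rw [Finset.mul_sum, Finset.mul_sum]
          refine Finset.sum_congr rfl fun j _ => ?_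
          rw [volume_closedBall_dyadicRadius j (a j) zero_le_two, ENNReal.ofReal_pow zero_le_two,
            ENNReal.ofReal_ofNat]
          ring
      _ ≤ _ := by
          gcongr
          exact (Finset.sum_le_sum hlow).trans hsumI
  have ht2 : t / 2 ≠ 0 := by simp [ht0]
  have ht2t : t / 2 ≠ ∞ := ENNReal.div_ne_top htt two_ne_zero
  have hS0 : t * volume {x | t / 2 ≤ ‖g0 x‖ₑ} ≤ 4 * A ^ 2 * (2 + 4 ^ n) * I := by
    have h1 : (t / 2) ^ 2 * volume {x | t / 2 ≤ ‖g0 x‖ₑ} ≤ A ^ 2 * ((2 + 4 ^ n) * t * I) := by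
      have h2 := mul_meas_ge_le_lintegral₀ (μ := volume)
        ((hg0.1.aestronglyMeasurable.enorm).pow_const 2) ((t / 2) ^ 2)
      have h3 : {x | (t / 2) ^ 2 ≤ ‖g0 x‖ₑ ^ 2} = {x | t / 2 ≤ ‖g0 x‖ₑ} := by
        ext x
        exact ENNReal.pow_le_pow_left_iff two_ne_zero
      rw [h3] at h2
      refine h2.trans (hg0b.trans ?_)
      gcongr
      exact lintegral_goodPart_sq_le hdisj hlow hupp hout
    have h4 : t / 2 * (t / 2 * volume {x | t / 2 ≤ ‖g0 x‖ₑ}) ≤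
        t / 2 * (2 * A ^ 2 * (2 + 4 ^ n) * I) := by
      calc _ = (t / 2) ^ 2 * volume {x | t / 2 ≤ ‖g0 x‖ₑ} := by ring
        _ ≤ _ := h1
        _ = A ^ 2 * ((2 + 4 ^ n) * (t / 2 * 2) * I) := by
            rw [ENNReal.div_mul_cancel two_ne_zero ENNReal.ofNat_ne_top]
        _ = _ := by ring
    have h5 := (ENNReal.mul_le_mul_iff_right ht2 ht2t).1 h4
    calc _ = 2 * (t / 2 * volume {x | t / 2 ≤ ‖g0 x‖ₑ}) := by
          rw [← mul_assoc, ENNReal.mul_div_cancel two_ne_zero ENNReal.ofNat_ne_top]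
      _ ≤ 2 * (2 * A ^ 2 * (2 + 4 ^ n) * I) := by gcongr
      _ = _ := by ring
  have hS1 : t * volume (Bᶜ ∩ {x | t / 2 ≤ ∑ j ∈ F, ‖G j x‖ₑ}) ≤ 4 * c * D * I := by
    have hGm : ∀ j, AEMeasurable (fun x => ‖G j x‖ₑ) volume :=
      fun j => (hG j).1.aestronglyMeasurable.enorm
    have h1 := mul_meas_ge_le_lintegral₀ (μ := volume.restrict Bᶜ)
      (Finset.aemeasurable_fun_sum F fun j _ => (hGm j).restrict) (t / 2)
    rw [Measure.restrict_apply₀' hBm.compl.nullMeasurableSet, inter_comm] at h1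
    have h2 : ∫⁻ x in Bᶜ, ∑ j ∈ F, ‖G j x‖ₑ ≤ 2 * c * D * I := by
      rw [lintegral_finsetSum' _ fun j _ => (hGm j).restrict]
      calc ∑ j ∈ F, ∫⁻ x in Bᶜ, ‖G j x‖ₑ
          ≤ ∑ j ∈ F, 2 * c * D * ∫⁻ y in dyadicCube j, ‖f y‖ₑ := by
            refine Finset.sum_le_sum fun j hj => ?_
            calc ∫⁻ x in Bᶜ, ‖G j x‖ₑ
                ≤ ∫⁻ x in (closedBall (a j) (2 * dyadicRadius n j.1))ᶜ, ‖G j x‖ₑ :=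
                  lintegral_mono_set (compl_subset_compl.2 fun x hx => mem_iUnion₂.2 ⟨j, hj, hx⟩)
              _ ≤ c * D * ∫⁻ y, ‖badPart f j y‖ₑ := by
                  refine h.lintegral_compl_le_of_integral_eq_zero hD (hG j)
                    (integrable_badPart hf j) (integral_badPart hf j) (dyadicRadius_pos n j.1)
                    fun y hy => indicator_of_notMem (fun hy' => hy ?_) _
                  exact mem_closedBall.2 (dist_le_of_mem_dyadicCube hy' (ha j))
              _ ≤ c * D * (2 * ∫⁻ y in dyadicCube j, ‖f y‖ₑ) := by
                  gcongr
                  exact lintegral_badPart_le hf j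
              _ = _ := by ring
        _ ≤ _ := by
            rw [← Finset.mul_sum]
            gcongr
    calc _ = 2 * (t / 2 * volume (Bᶜ ∩ {x | t / 2 ≤ ∑ j ∈ F, ‖G j x‖ₑ})) := by
          rw [← mul_assoc, ENNReal.mul_div_cancel two_ne_zero ENNReal.ofNat_ne_top]
      _ ≤ 2 * (2 * c * D * I) := by
          exact mul_le_mul' le_rfl (h1.trans h2)
      _ = _ := by ring
  have hcov : volume {x | t < ‖g x‖ₑ} ≤ volume (B ∪ {x | t / 2 ≤ ‖g0 x‖ₑ} ∪
      (Bᶜ ∩ {x | t / 2 ≤ ∑ j ∈ F, ‖G j x‖ₑ})) := by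
    refine measure_mono_ae ?_
    filter_upwards [hgeq] with x hx hxt
    by_contra hnot
    have hnot' : x ∉ B ∧ x ∉ {x | t / 2 ≤ ‖g0 x‖ₑ} ∧ x ∉ {x | t / 2 ≤ ∑ j ∈ F, ‖G j x‖ₑ} :=
      ⟨fun hh => hnot (Or.inl (Or.inl hh)), fun hh => hnot (Or.inl (Or.inr hh)),
        fun hh => hnot (Or.inr ⟨fun hb => hnot (Or.inl (Or.inl hb)), hh⟩)⟩
    obtain ⟨-, h1, h2⟩ := hnot'
    have h1 : ‖g0 x‖ₑ < t / 2 := not_le.1 h1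
    have h2 : ∑ j ∈ F, ‖G j x‖ₑ < t / 2 := not_le.1 h2
    have h3 : t < ‖g x‖ₑ := hxt
    rw [hx] at h3
    have h4 : ‖g0 x + ∑ j ∈ F, G j x‖ₑ ≤ ‖g0 x‖ₑ + ∑ j ∈ F, ‖G j x‖ₑ :=
      (enorm_add_le _ _).trans (by gcongr; exact enorm_sum_le _ _)
    have h5 := ENNReal.add_lt_add h1 h2
    rw [ENNReal.add_halves] at h5
    exact absurd (h3.trans_le h4) (not_lt.2 h5.le)
  calc t * volume {x | t < ‖g x‖ₑ} ≤ t * (volume B + volume {x | t / 2 ≤ ‖g0 x‖ₑ} +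
        volume (Bᶜ ∩ {x | t / 2 ≤ ∑ j ∈ F, ‖G j x‖ₑ})) := by
        gcongr
        refine hcov.trans ((measure_union_le _ _).trans ?_)
        gcongr
        exact measure_union_le _ _
    _ = t * volume B + t * volume {x | t / 2 ≤ ‖g0 x‖ₑ} +
        t * volume (Bᶜ ∩ {x | t / 2 ≤ ∑ j ∈ F, ‖G j x‖ₑ}) := by ring
    _ ≤ 2 ^ n * ballCubeRatio n * I + 4 * A ^ 2 * (2 + 4 ^ n) * I + 4 * c * D * I :=
        add_le_add (add_le_add hB hS0) hS1
    _ = _ := by push_cast; ring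

theorem lintegral_Ioo_rpow {q a : ℝ} (hq : 1 < q) (ha : 0 ≤ a) :
    ∫⁻ t in Ioo 0 a, ENNReal.ofReal (t ^ (q - 2)) = ENNReal.ofReal (a ^ (q - 1) / (q - 1)) := by
  have h1 : IntervalIntegrable (fun t : ℝ => t ^ (q - 2)) volume 0 a :=
    intervalIntegral.intervalIntegrable_rpow' (by linarith)
  rw [intervalIntegrable_iff_integrableOn_Ioo_of_le ha] at h1
  rw [← ofReal_integral_eq_lintegral_ofReal h1, ← integral_Ioc_eq_integral_Ioo,
    ← intervalIntegral.integral_of_le ha, integral_rpow (Or.inl (by linarith)),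
    Real.zero_rpow (by linarith), sub_zero]
  · congr 2 <;> [congr 1; skip] <;> ring
  · filter_upwards [ae_restrict_mem measurableSet_Ioo] with t ht
    exact Real.rpow_nonneg ht.1.le _

theorem lintegral_Ici_rpow {q a : ℝ} (hq : q < 2) (ha : 0 < a) :
    ∫⁻ t in Ici a, ENNReal.ofReal (t ^ (q - 3)) = ENNReal.ofReal (a ^ (q - 2) / (2 - q)) := by
  rw [setLIntegral_congr Ioi_ae_eq_Ici.symm, ← ofReal_integral_eq_lintegral_ofReal
    (integrableOn_Ioi_rpow_of_lt (by linarith) ha), integral_Ioi_rpow_of_lt (by linarith) ha]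
  · rw [← neg_div_neg_eq]
    congr 2 <;> ring_nf
  · filter_upwards [ae_restrict_mem measurableSet_Ioi] with t ht
    exact Real.rpow_nonneg (ha.trans ht).le _

/-- The contribution of the large values of `f` to the Marcinkiewicz interpolation integral. -/
theorem lintegral_rpow_mul_lintegral_large {q : ℝ} (hq : 1 < q) {f : Rn n → ℂ} (hf : Measurable f) :
    ∫⁻ t in Ioi (0 : ℝ), ENNReal.ofReal (t ^ (q - 2)) * ∫⁻ x in {x | t < ‖f x‖}, ‖f x‖ₑ =
      ENNReal.ofReal (1 / (q - 1)) * ∫⁻ x, ‖f x‖ₑ ^ q := by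
  have hset : ∀ t : ℝ, MeasurableSet {x | t < ‖f x‖} := fun t =>
    measurableSet_lt measurable_const hf.norm
  have hm : Measurable fun p : ℝ × Rn n =>
      {p : ℝ × Rn n | p.1 < ‖f p.2‖}.indicator
        (fun p => ENNReal.ofReal (p.1 ^ (q - 2)) * ‖f p.2‖ₑ) p :=
    Measurable.indicator (by fun_prop) (measurableSet_lt measurable_fst (hf.norm.comp measurable_snd))
  calc _ = ∫⁻ t in Ioi (0 : ℝ), ∫⁻ x, {p : ℝ × Rn n | p.1 < ‖f p.2‖}.indicator
        (fun p => ENNReal.ofReal (p.1 ^ (q - 2)) * ‖f p.2‖ₑ) (t, x) := by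
        refine lintegral_congr fun t => ?_
        rw [← lintegral_const_mul' _ _ ENNReal.ofReal_ne_top, ← lintegral_indicator (hset t)]
        rfl
    _ = ∫⁻ x, ∫⁻ t in Ioi (0 : ℝ), {p : ℝ × Rn n | p.1 < ‖f p.2‖}.indicator
        (fun p => ENNReal.ofReal (p.1 ^ (q - 2)) * ‖f p.2‖ₑ) (t, x) :=
        lintegral_lintegral_swap hm.aemeasurable
    _ = ∫⁻ x, ENNReal.ofReal (1 / (q - 1)) * ‖f x‖ₑ ^ q := by
        refine lintegral_congr fun x => ?_
        have e : ∀ t : ℝ, {p : ℝ × Rn n | p.1 < ‖f p.2‖}.indicator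
            (fun p => ENNReal.ofReal (p.1 ^ (q - 2)) * ‖f p.2‖ₑ) (t, x) =
            (Iio ‖f x‖).indicator (fun t => ENNReal.ofReal (t ^ (q - 2)) * ‖f x‖ₑ) t :=
          fun t => rfl
        simp_rw [e]
        rw [setLIntegral_indicator measurableSet_Iio, inter_comm, Ioi_inter_Iio,
          lintegral_mul_const' _ _ enorm_ne_top, lintegral_Ioo_rpow hq (norm_nonneg _),
          ← ofReal_norm, ENNReal.ofReal_rpow_of_nonneg (norm_nonneg _) (by linarith),
          ← ENNReal.ofReal_mul (div_nonneg (by positivity) (by linarith)),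
          ← ENNReal.ofReal_mul (div_nonneg zero_le_one (by linarith))]
        congr 1
        rcases (norm_nonneg (f x)).eq_or_lt with h0 | h0
        · rw [← h0, Real.zero_rpow (by linarith : q ≠ 0)]; simp
        · rw [Real.rpow_sub_one h0.ne']
          field_simp
    _ = _ := lintegral_const_mul' _ _ ENNReal.ofReal_ne_top

/-- The contribution of the small values of `f` to the Marcinkiewicz interpolation integral. -/
theorem lintegral_rpow_mul_lintegral_small {q : ℝ} (hq : 0 < q) (hq2 : q < 2) {f : Rn n → ℂ}
    (hf : Measurable f) :
    ∫⁻ t in Ioi (0 : ℝ), ENNReal.ofReal (t ^ (q - 3)) * ∫⁻ x in {x | ‖f x‖ ≤ t}, ‖f x‖ₑ ^ 2 =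
      ENNReal.ofReal (1 / (2 - q)) * ∫⁻ x, ‖f x‖ₑ ^ q := by
  have hset : ∀ t : ℝ, MeasurableSet {x | ‖f x‖ ≤ t} := fun t =>
    measurableSet_le hf.norm measurable_const
  have hm : Measurable fun p : ℝ × Rn n =>
      {p : ℝ × Rn n | ‖f p.2‖ ≤ p.1}.indicator
        (fun p => ENNReal.ofReal (p.1 ^ (q - 3)) * ‖f p.2‖ₑ ^ 2) p :=
    Measurable.indicator (by fun_prop) (measurableSet_le (hf.norm.comp measurable_snd) measurable_fst)
  calc _ = ∫⁻ t in Ioi (0 : ℝ), ∫⁻ x, {p : ℝ × Rn n | ‖f p.2‖ ≤ p.1}.indicator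
        (fun p => ENNReal.ofReal (p.1 ^ (q - 3)) * ‖f p.2‖ₑ ^ 2) (t, x) := by
        refine lintegral_congr fun t => ?_
        rw [← lintegral_const_mul' _ _ ENNReal.ofReal_ne_top, ← lintegral_indicator (hset t)]
        rfl
    _ = ∫⁻ x, ∫⁻ t in Ioi (0 : ℝ), {p : ℝ × Rn n | ‖f p.2‖ ≤ p.1}.indicator
        (fun p => ENNReal.ofReal (p.1 ^ (q - 3)) * ‖f p.2‖ₑ ^ 2) (t, x) :=
        lintegral_lintegral_swap hm.aemeasurable
    _ = ∫⁻ x, ENNReal.ofReal (1 / (2 - q)) * ‖f x‖ₑ ^ q := by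
        refine lintegral_congr fun x => ?_
        have e : ∀ t : ℝ, {p : ℝ × Rn n | ‖f p.2‖ ≤ p.1}.indicator
            (fun p => ENNReal.ofReal (p.1 ^ (q - 3)) * ‖f p.2‖ₑ ^ 2) (t, x) =
            (Ici ‖f x‖).indicator (fun t => ENNReal.ofReal (t ^ (q - 3)) * ‖f x‖ₑ ^ 2) t :=
          fun t => rfl
        simp_rw [e]
        rcases (norm_nonneg (f x)).eq_or_lt with h0 | h0
        · have : f x = 0 := norm_eq_zero.1 h0.symm
          simp [this, hq]
        · rw [setLIntegral_indicator measurableSet_Ici,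
            inter_eq_left.2 (show Ici ‖f x‖ ⊆ Ioi 0 from fun t ht => h0.trans_le ht),
            lintegral_mul_const' _ _ (ENNReal.pow_ne_top enorm_ne_top), lintegral_Ici_rpow hq2 h0,
            ← ofReal_norm, ENNReal.ofReal_rpow_of_nonneg (norm_nonneg _) hq.le,
            ← ENNReal.ofReal_pow (norm_nonneg _),
            ← ENNReal.ofReal_mul (div_nonneg (by positivity) (by linarith)),
            ← ENNReal.ofReal_mul (div_nonneg zero_le_one (by linarith))]
          congr 1
          rw [Real.rpow_sub h0, Real.rpow_two]
          field_simp
    _ = _ := lintegral_const_mul' _ _ ENNReal.ofReal_ne_top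

theorem KernelData.exists_strongType_lt_two {K : 𝓢'(Rn n, ℂ)} {k m : Rn n → ℂ} {A c : ℝ≥0}
    (h : KernelData K k m A c) (hn : n ≠ 0) {q : ℝ} (hq : 1 < q) (hq2 : q < 2) :
    ∃ C : ℝ≥0, ∀ f g : Rn n → ℂ, Measurable f → MemLp f 2 volume → IsConvolution K f g →
      ∫⁻ x, ‖g x‖ₑ ^ q ≤ C * ∫⁻ x, ‖f x‖ₑ ^ q := by
  obtain ⟨C₁, hC₁⟩ := h.exists_weakType_one hn
  refine ⟨(2 ^ q * q * (C₁ * (1 / (q - 1)) + A ^ 2 * (1 / (2 - q)))).toNNReal,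
    fun f g hf hf2 hfg => ?_⟩
  have hq0 : 0 < q := by linarith
  set I := ∫⁻ x, ‖f x‖ₑ ^ q
  have hlevel : ∀ t : ℝ, 0 < t → volume {x | t < ‖g x‖ / 2} * ENNReal.ofReal (t ^ (q - 1)) ≤
      C₁ * (ENNReal.ofReal (t ^ (q - 2)) * ∫⁻ x in {x | t < ‖f x‖}, ‖f x‖ₑ) +
      A ^ 2 * (ENNReal.ofReal (t ^ (q - 3)) * ∫⁻ x in {x | ‖f x‖ ≤ t}, ‖f x‖ₑ ^ 2) := by
    intro t ht
    have hS : MeasurableSet {x | t < ‖f x‖} := measurableSet_lt measurable_const hf.norm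
    have hS' : MeasurableSet {x | ‖f x‖ ≤ t} := measurableSet_le hf.norm measurable_const
    set T := ENNReal.ofReal t with hT
    have hT0 : T ≠ 0 := (ENNReal.ofReal_pos.2 ht).ne'
    have hTt : T ≠ ∞ := ENNReal.ofReal_ne_top
    let u : Rn n → ℂ := {x | t < ‖f x‖}.indicator f
    let v : Rn n → ℂ := {x | ‖f x‖ ≤ t}.indicator f
    have huv : ∀ x, u x + v x = f x := by
      intro x
      by_cases hx : t < ‖f x‖
      · simp only [u, v]
        rw [indicator_of_mem (show x ∈ {x | t < ‖f x‖} from hx),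
          indicator_of_notMem (show x ∉ {x | ‖f x‖ ≤ t} from not_le.2 hx), add_zero]
      · simp only [u, v]
        rw [indicator_of_notMem (show x ∉ {x | t < ‖f x‖} from hx),
          indicator_of_mem (show x ∈ {x | ‖f x‖ ≤ t} from not_lt.1 hx), zero_add]
    have hu2 : MemLp u 2 volume := hf2.indicator hS
    have hv2 : MemLp v 2 volume := hf2.indicator hS'
    have hui : Integrable u volume := by
      refine Integrable.mono' ((hf2.integrable_norm_pow two_ne_zero).const_mul t⁻¹) hu2.1
        (Eventually.of_forall fun x => ?_)
      by_cases hx : t < ‖f x‖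
      · simp only [u, indicator_of_mem (show x ∈ {x | t < ‖f x‖} from hx)]
        rw [← div_eq_inv_mul, le_div_iff₀ ht, sq]
        gcongr
      · simp only [u, indicator_of_notMem (show x ∉ {x | t < ‖f x‖} from hx), norm_zero]
        positivity
    obtain ⟨gu, hgu, -⟩ := h.exists_isConvolution_two hn hu2
    obtain ⟨gv, hgv, hgvb⟩ := h.exists_isConvolution_two hn hv2
    have hg : g =ᵐ[volume] fun x => gu x + gv x :=
      hfg.unique ((hgu.add hgv).congr_left (Eventually.of_forall huv))
    have w1 := hC₁ u gu hui hu2 hgu T hT0 hTt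
    have w2 : T ^ 2 * volume {x | T < ‖gv x‖ₑ} ≤ A ^ 2 * ∫⁻ x, ‖v x‖ₑ ^ 2 := by
      have := mul_meas_ge_le_lintegral₀ (μ := volume)
        ((hgv.1.aestronglyMeasurable.enorm).pow_const 2) (T ^ 2)
      refine le_trans (mul_le_mul' le_rfl (measure_mono fun x hx => ?_)) (this.trans hgvb)
      exact (ENNReal.pow_le_pow_left_iff two_ne_zero).2 (le_of_lt hx)
    have eu : ∫⁻ x, ‖u x‖ₑ = ∫⁻ x in {x | t < ‖f x‖}, ‖f x‖ₑ := by
      simp only [u]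
      simp_rw [enorm_indicator_eq_indicator_enorm]
      exact lintegral_indicator hS _
    have ev : ∫⁻ x, ‖v x‖ₑ ^ 2 = ∫⁻ x in {x | ‖f x‖ ≤ t}, ‖f x‖ₑ ^ 2 := by
      rw [← lintegral_indicator hS']
      refine lintegral_congr fun x => ?_
      by_cases hx : x ∈ {x | ‖f x‖ ≤ t}
      · simp only [v, indicator_of_mem hx]
      · simp [v, indicator_of_notMem hx]
    rw [eu] at w1
    rw [ev] at w2
    have hcov : volume {x | t < ‖g x‖ / 2} ≤
        volume {x | T < ‖gu x‖ₑ} + volume {x | T < ‖gv x‖ₑ} := by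
      refine le_trans (measure_mono_ae ?_) (measure_union_le _ _)
      filter_upwards [hg] with x hx hxt
      have hxt : t < ‖g x‖ / 2 := hxt
      by_contra hnot
      have h1 : ¬ T < ‖gu x‖ₑ := fun hh => hnot (Or.inl hh)
      have h2 : ¬ T < ‖gv x‖ₑ := fun hh => hnot (Or.inr hh)
      rw [not_lt, hT, ← ofReal_norm, ENNReal.ofReal_le_ofReal_iff ht.le] at h1 h2
      rw [hx] at hxt
      linarith [norm_add_le (gu x) (gv x)]
    have p1 : ENNReal.ofReal (t ^ (q - 1)) = T * ENNReal.ofReal (t ^ (q - 2)) := by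
      rw [hT, ← ENNReal.ofReal_mul ht.le, ← Real.rpow_one_add' ht.le (by linarith)]
      congr 2; ring
    have p2 : ENNReal.ofReal (t ^ (q - 1)) = T ^ 2 * ENNReal.ofReal (t ^ (q - 3)) := by
      rw [hT, ← ENNReal.ofReal_pow ht.le, ← ENNReal.ofReal_mul (by positivity), ← Real.rpow_natCast,
        ← Real.rpow_add ht]
      congr 2; push_cast; ring
    calc _ ≤ (volume {x | T < ‖gu x‖ₑ} + volume {x | T < ‖gv x‖ₑ}) *
          ENNReal.ofReal (t ^ (q - 1)) := by gcongr
      _ = ENNReal.ofReal (t ^ (q - 2)) * (T * volume {x | T < ‖gu x‖ₑ}) +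
          ENNReal.ofReal (t ^ (q - 3)) * (T ^ 2 * volume {x | T < ‖gv x‖ₑ}) := by
          rw [add_mul]
          nth_rewrite 1 [p1]
          rw [p2]
          ring
      _ ≤ ENNReal.ofReal (t ^ (q - 2)) * (C₁ * ∫⁻ x in {x | t < ‖f x‖}, ‖f x‖ₑ) +
          ENNReal.ofReal (t ^ (q - 3)) * (A ^ 2 * ∫⁻ x in {x | ‖f x‖ ≤ t}, ‖f x‖ₑ ^ 2) := by gcongr
      _ = _ := by ring
  have hlayer := lintegral_rpow_eq_lintegral_meas_lt_mul (volume : Measure (Rn n))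
    (f := fun x => ‖g x‖ / 2) (Eventually.of_forall fun x => by positivity)
    (hfg.1.aestronglyMeasurable.norm.aemeasurable.div_const 2) hq0
  have hm1 : Measurable fun t : ℝ =>
      ENNReal.ofReal (t ^ (q - 2)) * ∫⁻ x in {x | t < ‖f x‖}, ‖f x‖ₑ := by
    refine Measurable.mul (by fun_prop) (Antitone.measurable fun s t hst => ?_)
    exact lintegral_mono_set fun x hx => lt_of_le_of_lt hst hx
  have hint : ∫⁻ t in Ioi (0 : ℝ), volume {x | t < ‖g x‖ / 2} * ENNReal.ofReal (t ^ (q - 1)) ≤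
      C₁ * (ENNReal.ofReal (1 / (q - 1)) * I) + A ^ 2 * (ENNReal.ofReal (1 / (2 - q)) * I) := by
    calc _ ≤ ∫⁻ t in Ioi (0 : ℝ),
          (C₁ * (ENNReal.ofReal (t ^ (q - 2)) * ∫⁻ x in {x | t < ‖f x‖}, ‖f x‖ₑ) +
          A ^ 2 * (ENNReal.ofReal (t ^ (q - 3)) * ∫⁻ x in {x | ‖f x‖ ≤ t}, ‖f x‖ₑ ^ 2)) :=
          setLIntegral_mono' measurableSet_Ioi fun t ht => hlevel t ht
      _ = _ := by
          rw [lintegral_add_left (hm1.const_mul _), lintegral_const_mul' _ _ ENNReal.coe_ne_top,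
            lintegral_const_mul' _ _ (ENNReal.pow_ne_top ENNReal.coe_ne_top),
            lintegral_rpow_mul_lintegral_large hq hf,
            lintegral_rpow_mul_lintegral_small hq0 hq2 hf]
  have hscale : ∫⁻ x, ‖g x‖ₑ ^ q =
      ENNReal.ofReal (2 ^ q) * ∫⁻ x, ENNReal.ofReal ((‖g x‖ / 2) ^ q) := by
    rw [← lintegral_const_mul' _ _ ENNReal.ofReal_ne_top]
    refine lintegral_congr fun x => ?_
    rw [← ENNReal.ofReal_mul (by positivity), ← Real.mul_rpow zero_le_two (by positivity),
      mul_div_cancel₀ _ two_ne_zero, ← ofReal_norm,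
      ENNReal.ofReal_rpow_of_nonneg (norm_nonneg _) hq0.le]
  have hq1 : 0 < q - 1 := by linarith
  have hq3 : 0 < 2 - q := by linarith
  rw [hscale, hlayer]
  calc _ ≤ ENNReal.ofReal (2 ^ q) * (ENNReal.ofReal q *
        (C₁ * (ENNReal.ofReal (1 / (q - 1)) * I) + A ^ 2 * (ENNReal.ofReal (1 / (2 - q)) * I))) := by
        gcongr
    _ = ENNReal.ofReal (2 ^ q * q * (C₁ * (1 / (q - 1)) + A ^ 2 * (1 / (2 - q)))) * I := by
        rw [ENNReal.ofReal_mul (by positivity), ENNReal.ofReal_mul (by positivity),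
          ENNReal.ofReal_add (by positivity) (by positivity), ENNReal.ofReal_mul (by positivity),
          ENNReal.ofReal_mul (by positivity), ENNReal.ofReal_pow (by positivity),
          ENNReal.ofReal_coe_nnreal, ENNReal.ofReal_coe_nnreal]
        ring
    _ = _ := rfl

namespace KernelData

variable {K : 𝓢'(Rn n, ℂ)} {k m : Rn n → ℂ} {A c : ℝ≥0}

theorem exists_eLpNorm_transposeConv_le_of_lt_two (h : KernelData K k m A c) (hn : n ≠ 0) {q : ℝ}
    (hq : 1 < q) (hq2 : q < 2) :
    ∃ C : ℝ≥0, ∀ θ : 𝓢(Rn n, ℂ), HasCompactSupport θ →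
      eLpNorm (transposeConv K θ) (ENNReal.ofReal q) volume ≤
        C * eLpNorm θ (ENNReal.ofReal q) volume := by
  have hq0 : 0 < q := by linarith
  obtain ⟨C, hC⟩ := h.reflect.exists_strongType_lt_two hn hq hq2
  refine ⟨C ^ (1 / q), fun θ hθ => ?_⟩
  rw [eLpNorm_le_mul_iff hq0, ENNReal.coe_rpow_of_nonneg _ (by positivity), ← ENNReal.rpow_mul,
    one_div, inv_mul_cancel₀ hq0.ne', ENNReal.rpow_one]
  exact hC θ _ θ.continuous.measurable (θ.memLp 2 volume) (h.isConvolution_reflect_transposeConv hθ)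

/-- Convolution with a Calderón–Zygmund kernel is bounded on test functions for the norm of `L^q`,
for each `1 < q < ∞`. -/
theorem exists_eLpNorm_transposeConv_le (h : KernelData K k m A c) (hn : n ≠ 0) {q : ℝ}
    (hq : 1 < q) :
    ∃ C : ℝ≥0, ∀ θ : 𝓢(Rn n, ℂ), HasCompactSupport θ →
      eLpNorm (transposeConv K θ) (ENNReal.ofReal q) volume ≤
        C * eLpNorm θ (ENNReal.ofReal q) volume := by
  rcases lt_trichotomy q 2 with hq2 | rfl | hq2
  · exact h.exists_eLpNorm_transposeConv_le_of_lt_two hn hq hq2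
  · exact ⟨A, fun θ _ => h.eLpNorm_two_transposeConv_le θ⟩
  have hq0 : 0 < q := by linarith
  obtain ⟨r, hqr⟩ : ∃ r, q.HolderConjugate r := ⟨_, Real.HolderConjugate.conjExponent hq⟩
  have hr0 : 0 < r := hqr.symm.pos
  have hr2 : r < 2 := by
    have h1 := hqr.inv_add_inv_eq_one
    have h2 : q⁻¹ < 2⁻¹ := inv_strictAnti₀ two_pos hq2
    have h3 : 2⁻¹ < r⁻¹ := by norm_num at h2 ⊢; linarith
    exact (inv_lt_inv₀ two_pos hr0).1 h3
  obtain ⟨C, hC⟩ := h.reflect.exists_eLpNorm_transposeConv_le_of_lt_two hn hqr.symm.lt hr2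
  refine ⟨C, fun θ hθ => ?_⟩
  have hθq : MemLp θ (ENNReal.ofReal q) volume := θ.memLp (ENNReal.ofReal q) volume
  obtain ⟨B, hB⟩ : ∃ B : ℝ≥0, (B : ℝ≥0∞) = C * eLpNorm θ (ENNReal.ofReal q) volume :=
    ⟨_, ENNReal.coe_toNNReal (ENNReal.mul_ne_top ENNReal.coe_ne_top hθq.eLpNorm_lt_top.ne)⟩
  have key : ∫⁻ x, ‖transposeConv K θ x‖ₑ ^ q ≤ (B : ℝ≥0∞) ^ q := by
    refine lintegral_rpow_le_of_schwartz (h.continuous_transposeConv θ).locallyIntegrable hqr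
      fun φ hφ => ?_
    rw [hB, ← eLpNorm_ofReal_eq (f := φ) hr0, h.integral_transposeConv_mul]
    have hS := h.reflect.continuous_transposeConv φ
    calc ‖∫ x, θ x * transposeConv (VarLp.reflect K) φ x‖ₑ
        ≤ ∫⁻ x, ‖θ x‖ₑ * ‖transposeConv (VarLp.reflect K) φ x‖ₑ := by
          refine (enorm_integral_le_lintegral_enorm _).trans (le_of_eq ?_)
          simp_rw [enorm_mul]
      _ ≤ (∫⁻ x, ‖θ x‖ₑ ^ q) ^ (1 / q) *
            (∫⁻ x, ‖transposeConv (VarLp.reflect K) φ x‖ₑ ^ r) ^ (1 / r) :=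
          ENNReal.lintegral_mul_le_Lp_mul_Lq volume hqr θ.continuous.enorm.aemeasurable
            hS.enorm.aemeasurable
      _ = eLpNorm θ (ENNReal.ofReal q) volume *
            eLpNorm (transposeConv (VarLp.reflect K) φ) (ENNReal.ofReal r) volume := by
          rw [eLpNorm_ofReal_eq hq0, eLpNorm_ofReal_eq hr0]
      _ ≤ eLpNorm θ (ENNReal.ofReal q) volume * (C * eLpNorm φ (ENNReal.ofReal r) volume) := by
          gcongr
          exact hC φ hφ
      _ = _ := by ring
  rw [lintegral_rpow_eq_eLpNorm hq0, ENNReal.rpow_le_rpow_iff hq0, hB] at key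
  exact key

/-- The Calderón–Zygmund theorem: convolution with `K` is bounded on `L^q`, `1 < q < ∞`. -/
theorem exists_isConvolution_of_memLp (h : KernelData K k m A c) (hn : n ≠ 0) {q : ℝ}
    (hq : 1 < q) :
    ∃ C : ℝ≥0, ∀ f : Rn n → ℂ, MemLp f (ENNReal.ofReal q) volume →
      ∃ g, IsConvolution K f g ∧ ∫⁻ x, ‖g x‖ₑ ^ q ≤ C * ∫⁻ x, ‖f x‖ₑ ^ q := by
  have hq0 : 0 < q := by linarith
  obtain ⟨C, hC⟩ := h.reflect.exists_eLpNorm_transposeConv_le hn hq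
  refine ⟨C ^ q, fun f hf => ?_⟩
  obtain ⟨g, hg, -, hgb⟩ := h.exists_isConvolution hn hq hC hf
  rw [eLpNorm_le_mul_iff hq0, ← ENNReal.coe_rpow_of_nonneg _ hq0.le] at hgb
  exact ⟨g, hg, hgb⟩

end KernelData

theorem exists_lt_ae_of_lt_pMinus {p : Rn n → ℝ} (h : 1 < pMinus p) :
    ∃ a : ℝ, 1 < a ∧ ∀ᵐ x ∂(volume : Measure (Rn n)), a ≤ p x := by
  obtain ⟨a, ha1, ha⟩ := ENNReal.lt_iff_exists_nnreal_btwn.1 h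
  refine ⟨a, by exact_mod_cast ha1, ?_⟩
  filter_upwards [ae_lt_of_lt_essInf ha] with x hx
  have hx' := hx.le
  rw [← ENNReal.ofReal_coe_nnreal, ENNReal.ofReal_le_ofReal_iff'] at hx'
  rcases hx' with h1 | h1
  · exact h1
  · have : (1 : ℝ) < a := by exact_mod_cast ha1
    linarith

theorem exists_ae_le_of_pPlus_lt {p : Rn n → ℝ} (h : pPlus p < ∞) :
    ∃ b : ℝ, 1 < b ∧ ∀ᵐ x ∂(volume : Measure (Rn n)), p x ≤ b := by
  refine ⟨max (pPlus p).toReal 2, by simp, ?_⟩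
  filter_upwards [ENNReal.ae_le_essSup fun x => ENNReal.ofReal (p x)] with x hx
  exact ((ENNReal.ofReal_le_iff_le_toReal h.ne).1 hx).trans (le_max_left _ _)

theorem KernelData.exists_isConvolution_of_memVarLp {K : 𝓢'(Rn n, ℂ)} {k m : Rn n → ℂ}
    {A c : ℝ≥0} (h : KernelData K k m A c) (hn : n ≠ 0) {p : Rn n → ℝ}
    (hpm : 1 < pMinus p) (hpp : pPlus p < ∞) {f : Rn n → ℂ} (hf : MemVarLp p f) :
    ∃ g, IsConvolution K f g := by
  obtain ⟨a, ha1, ha⟩ := exists_lt_ae_of_lt_pMinus hpm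
  obtain ⟨b, hb1, hb⟩ := exists_ae_le_of_pPlus_lt hpp
  obtain ⟨hfm, r, hr, hfr⟩ := hf
  set w : Rn n → ℂ := fun x => f x / (r : ℂ) with hw
  have hwm : AEStronglyMeasurable w volume := by
    simp only [hw, div_eq_mul_inv]
    exact hfm.mul_const _
  let S : Set (Rn n) := {x | 1 < ‖w x‖ₑ}
  have hS : NullMeasurableSet S volume := nullMeasurableSet_lt aemeasurable_const hwm.enorm
  have ha0 : 0 < a := by linarith
  have hb0 : 0 < b := by linarith
  have h1 : MemLp (S.indicator w) (ENNReal.ofReal a) volume := by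
    refine (memLp_ofReal_iff ha0).2 ⟨hwm.indicator₀ hS, lt_of_le_of_lt (lintegral_mono_ae ?_) hfr⟩
    filter_upwards [ha] with x hx
    by_cases hxS : x ∈ S
    · rw [indicator_of_mem hxS]
      exact ENNReal.rpow_le_rpow_of_exponent_le (le_of_lt hxS) hx
    · rw [indicator_of_notMem hxS]
      simp [ha0]
  have h2 : MemLp (Sᶜ.indicator w) (ENNReal.ofReal b) volume := by
    refine (memLp_ofReal_iff hb0).2
      ⟨hwm.indicator₀ hS.compl, lt_of_le_of_lt (lintegral_mono_ae ?_) hfr⟩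
    filter_upwards [hb] with x hx
    by_cases hxS : x ∈ Sᶜ
    · rw [indicator_of_mem hxS]
      exact ENNReal.rpow_le_rpow_of_exponent_ge (not_lt.1 hxS) hx
    · rw [indicator_of_notMem hxS]
      simp [hb0]
  obtain ⟨_, H1⟩ := h.exists_isConvolution_of_memLp hn ha1
  obtain ⟨_, H2⟩ := h.exists_isConvolution_of_memLp hn hb1
  obtain ⟨g1, hg1, -⟩ := H1 _ h1
  obtain ⟨g2, hg2, -⟩ := H2 _ h2
  refine ⟨_, ((hg1.add hg2).const_mul (r : ℂ)).congr_left (Eventually.of_forall fun x => ?_)⟩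
  simp only
  rw [indicator_self_add_compl_apply, hw, mul_div_cancel₀]
  exact_mod_cast hr.ne'

theorem KernelData.exists_modular_le_of_ae_const {K : 𝓢'(Rn n, ℂ)} {k m : Rn n → ℂ}
    {A c : ℝ≥0} (h : KernelData K k m A c) (hn : n ≠ 0) {p : Rn n → ℝ}
    (hpm : 1 < pMinus p) {q : ℝ} (hq : ∀ᵐ x ∂(volume : Measure (Rn n)), p x = q) :
    ∃ C : ℝ≥0, ∀ f : Rn n → ℂ, MemVarLp p f → ∀ g : Rn n → ℂ, IsConvolution K f g →
      modular p g ≤ C * modular p f := by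
  obtain ⟨a, ha1, ha⟩ := exists_lt_ae_of_lt_pMinus hpm
  have hq1 : 1 < q := by
    obtain ⟨x, hx, hx'⟩ := (hq.and ha).exists
    linarith
  have hq0 : 0 < q := by linarith
  have hmod : ∀ f : Rn n → ℂ, modular p f = ∫⁻ x, ‖f x‖ₑ ^ q := fun f =>
    lintegral_congr_ae (hq.mono fun x hx => by simp only [hx])
  obtain ⟨C, hC⟩ := h.exists_isConvolution_of_memLp hn hq1
  refine ⟨C, fun f hf g hg => ?_⟩
  obtain ⟨hfm, r, hr, hfr⟩ := hf
  have hr' : (r : ℂ) ≠ 0 := by exact_mod_cast hr.ne'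
  have hfL : MemLp f (ENNReal.ofReal q) volume := by
    have h1 : MemLp (fun x => f x / (r : ℂ)) (ENNReal.ofReal q) volume := by
      refine (memLp_ofReal_iff hq0).2 ⟨?_, by rwa [← hmod]⟩
      simpa only [div_eq_mul_inv] using hfm.mul_const ((r : ℂ)⁻¹)
    have h2 := h1.const_mul (r : ℂ)
    refine h2.ae_eq (Eventually.of_forall fun x => ?_)
    change (r : ℂ) * (f x / r) = f x
    field_simp
  obtain ⟨g', hg', hb⟩ := hC f hfL
  have hgg : ∫⁻ x, ‖g x‖ₑ ^ q = ∫⁻ x, ‖g' x‖ₑ ^ q :=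
    lintegral_congr_ae ((hg.unique hg').mono fun x hx => by simp only [hx])
  rw [hmod, hmod, hgg]
  exact hb

/-- If `k` is bounded below at `t • u`, then it is nearly constant in a ball around `t • u` whose
radius is a fixed fraction of `|t|`. -/
theorem KernelData.norm_kernel_sub_le_half {K : 𝓢'(Rn n, ℂ)} {k m : Rn n → ℂ} {A c : ℝ≥0}
    (h : KernelData K k m A c) {u : Rn n} (hu : ‖u‖ = 1) {c' : ℝ} (hc' : 0 < c')
    (hlow : ∀ t : ℝ, t ≠ 0 → c' / ‖t • u‖ ^ n ≤ ‖k (t • u)‖) {t ρ : ℝ} (hρ : 0 < ρ)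
    (ht : (5 + 4 * c / c') * ρ ≤ |t|) {z : Rn n} (hz : ‖t • u - z‖ ≤ 2 * ρ) :
    ‖k (t • u) - k z‖ ≤ ‖k (t • u)‖ / 2 := by
  have hc0 : (0 : ℝ) ≤ c := c.2
  have hfrac : 0 ≤ 4 * c / c' * ρ := by positivity
  have ht5 : 5 * ρ ≤ |t| := by linarith [add_mul (5 : ℝ) (4 * c / c') ρ]
  have ht0 : 0 < |t| := by linarith
  have htc : 4 * c * ρ ≤ c' * |t| := by
    have h1 : 4 * c / c' * ρ ≤ |t| := by linarith [add_mul (5 : ℝ) (4 * c / c') ρ]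
    calc 4 * c * ρ = c' * (4 * c / c' * ρ) := by field_simp
      _ ≤ c' * |t| := by gcongr
  have hn : ‖t • u‖ = |t| := by rw [norm_smul, hu, mul_one, Real.norm_eq_abs]
  have h1 := h.smooth (t • u) (t • u - z) (by rw [hn]; linarith)
  rw [sub_sub_cancel, hn] at h1
  have h2 := hlow t (abs_pos.1 ht0)
  rw [hn] at h2
  calc ‖k (t • u) - k z‖ ≤ c * ‖t • u - z‖ / |t| ^ (n + 1) := h1
    _ ≤ (c' * |t| / 2) / |t| ^ (n + 1) := by
        gcongr
        calc c * ‖t • u - z‖ ≤ c * (2 * ρ) := by gcongr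
          _ ≤ c' * |t| / 2 := by linarith
    _ = c' / |t| ^ n / 2 := by
        rw [pow_succ]
        field_simp
    _ ≤ ‖k (t • u)‖ / 2 := by gcongr

theorem memVarLp_indicator_const {p : Rn n → ℝ} (hp1 : ∀ x, 1 ≤ p x) {E : Set (Rn n)}
    (hE : MeasurableSet E) (hEv : volume E < ∞) {α T : ℝ} (hT : 1 ≤ T) (hα : ∀ x ∈ E, p x ≤ α) :
    MemVarLp p (E.indicator fun _ => (T : ℂ)) ∧
      modular p (E.indicator fun _ => (T : ℂ)) ≤ ENNReal.ofReal T ^ α * volume E := by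
  have hmod : modular p (E.indicator fun _ => (T : ℂ)) ≤ ENNReal.ofReal T ^ α * volume E := by
    rw [← lintegral_indicator_const hE]
    refine lintegral_mono fun x => ?_
    by_cases hx : x ∈ E
    · simp only [indicator_of_mem hx]
      rw [show ‖(T : ℂ)‖ₑ = ENNReal.ofReal T by
        rw [← ofReal_norm, Complex.norm_real, Real.norm_of_nonneg (by linarith)]]
      exact ENNReal.rpow_le_rpow_of_exponent_le (ENNReal.one_le_ofReal.2 hT) (hα x hx)
    · have : 0 < p x := by linarith [hp1 x]
      simp [indicator_of_notMem hx, this]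
  refine ⟨⟨(measurable_const.indicator hE).aestronglyMeasurable, 1, one_pos, ?_⟩, hmod⟩
  simp only [Complex.ofReal_one, div_one]
  refine hmod.trans_lt (ENNReal.mul_lt_top ?_ hEv)
  rw [ENNReal.ofReal_rpow_of_pos (by linarith)]
  exact ENNReal.ofReal_lt_top

/-- The convolution of an indicator function with the kernel is large on a neighbouring ball. -/
theorem KernelData.ae_le_norm_of_indicator {K : 𝓢'(Rn n, ℂ)} {k m : Rn n → ℂ} {A c : ℝ≥0}
    (h : KernelData K k m A c) {v : Rn n} {ρ T : ℝ} (hT : 0 ≤ T)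
    (hv : 2 * ρ < ‖v‖) (hk : ∀ z, ‖v - z‖ ≤ 2 * ρ → ‖k v - k z‖ ≤ ‖k v‖ / 2) {a : Rn n}
    {E : Set (Rn n)} (hE : MeasurableSet E) (hEa : E ⊆ closedBall a ρ) {g : Rn n → ℂ}
    (hg : IsConvolution K (E.indicator fun _ => (T : ℂ)) g) :
    ∀ᵐ x ∂(volume : Measure (Rn n)), x ∈ closedBall (a + v) ρ →
      T * (‖k v‖ / 2 * volume.real E) ≤ ‖g x‖ := by
  have hEv : volume E < ∞ := (measure_mono hEa).trans_lt measure_closedBall_lt_top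
  have hfi : Integrable (E.indicator fun _ => (T : ℂ)) volume :=
    (integrable_indicator_iff hE).2 (integrableOn_const hEv.ne)
  have hf0 : ∀ y, y ∉ closedBall a ρ → E.indicator (fun _ => (T : ℂ)) y = 0 := fun y hy =>
    indicator_of_notMem (fun hy' => hy (hEa hy')) _
  filter_upwards [h.ae_eq_integral hg hfi hf0] with x hx hxB
  have hxa : x ∉ closedBall a ρ := by
    intro hxa
    rw [mem_closedBall, dist_eq_norm] at hxa hxB
    have : ‖v‖ ≤ ‖x - a‖ + ‖x - (a + v)‖ := by
      calc ‖v‖ = ‖(x - a) - (x - (a + v))‖ := by congr 1; abel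
        _ ≤ _ := norm_sub_le _ _
    linarith
  have hmul : (fun y => k (x - y) * E.indicator (fun _ => (T : ℂ)) y) =
      E.indicator fun y => k (x - y) * T := by
    ext y
    by_cases hy : y ∈ E <;> simp [hy]
  have hint := h.integrable_kernel_mul hfi hf0 hxa
  rw [hmul, integrable_indicator_iff hE] at hint
  have hgx := hx hxa
  rw [hmul, integral_indicator hE] at hgx
  have hclose : ‖∫ y in E, (k v * T - k (x - y) * T)‖ ≤ ‖k v‖ / 2 * T * volume.real E := by
    refine norm_setIntegral_le_of_norm_le_const hEv fun y hy => ?_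
    rw [← sub_mul, norm_mul, Complex.norm_real, Real.norm_of_nonneg hT]
    gcongr
    refine hk _ ?_
    have hy' := hEa hy
    rw [mem_closedBall, dist_eq_norm] at hxB hy'
    calc ‖v - (x - y)‖ = ‖(y - a) - (x - (a + v))‖ := by congr 1; abel
      _ ≤ ‖y - a‖ + ‖x - (a + v)‖ := norm_sub_le _ _
      _ ≤ 2 * ρ := by linarith
  have hconst : Integrable (fun _ => k v * (T : ℂ)) (volume.restrict E) :=
    integrableOn_const hEv.ne
  rw [integral_sub hconst hint, ← hgx, setIntegral_const] at hclose
  have hnorm : ‖volume.real E • (k v * (T : ℂ))‖ = volume.real E * (‖k v‖ * T) := by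
    rw [norm_smul, norm_mul, Complex.norm_real, Real.norm_of_nonneg hT,
      Real.norm_of_nonneg measureReal_nonneg]
  have := norm_sub_norm_le (volume.real E • (k v * (T : ℂ))) (g x)
  rw [hnorm] at this
  nlinarith

/-- The modular inequality excludes that `p` takes small values on a set of positive measure in a
ball, and large values on a set of positive measure in a neighbouring ball. -/
theorem KernelData.measure_eq_zero_of_modular_le {K : 𝓢'(Rn n, ℂ)} {k m : Rn n → ℂ} {A c : ℝ≥0}
    (h : KernelData K k m A c) {p : Rn n → ℝ} (hp1 : ∀ x, 1 ≤ p x)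
    (hex : ∀ f : Rn n → ℂ, MemVarLp p f → ∃ g, IsConvolution K f g) {C : ℝ≥0}
    (hC : ∀ f : Rn n → ℂ, MemVarLp p f → ∀ g : Rn n → ℂ, IsConvolution K f g →
      modular p g ≤ C * modular p f)
    {v : Rn n} {ρ : ℝ} (hv : 2 * ρ < ‖v‖) (hkv : 0 < ‖k v‖)
    (hk : ∀ z, ‖v - z‖ ≤ 2 * ρ → ‖k v - k z‖ ≤ ‖k v‖ / 2) {a : Rn n}
    {E F : Set (Rn n)} (hE : MeasurableSet E) (hF : MeasurableSet F) (hEa : E ⊆ closedBall a ρ)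
    (hFa : F ⊆ closedBall (a + v) ρ) {α β : ℝ} (hαβ : α < β) (hα : ∀ x ∈ E, p x ≤ α)
    (hβ : ∀ x ∈ F, β ≤ p x) (hE0 : volume E ≠ 0) : volume F = 0 := by
  by_contra hF0
  have hEv : volume E < ∞ := (measure_mono hEa).trans_lt measure_closedBall_lt_top
  have hFv : volume F < ∞ := (measure_mono hFa).trans_lt measure_closedBall_lt_top
  have hEr : 0 < volume.real E := ENNReal.toReal_pos hE0 hEv.ne
  have hFr : 0 < volume.real F := ENNReal.toReal_pos hF0 hFv.ne
  set δ : ℝ := ‖k v‖ / 2 * volume.real E with hδdef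
  have hδ : 0 < δ := by positivity
  have key : ∀ T : ℝ, 1 ≤ T → 1 ≤ T * δ →
      T ^ (β - α) ≤ C * volume.real E / (δ ^ β * volume.real F) := by
    intro T hT hTδ
    have hT0 : 0 < T := by linarith
    obtain ⟨hf, hfm⟩ := memVarLp_indicator_const hp1 hE hEv hT hα
    obtain ⟨g, hg⟩ := hex _ hf
    have hlow : ENNReal.ofReal (T * δ) ^ β * volume F ≤ modular p g := by
      rw [← setLIntegral_const]
      refine le_trans (lintegral_mono_ae ?_) (setLIntegral_le_lintegral F _)
      rw [ae_restrict_iff' hF]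
      filter_upwards [h.ae_le_norm_of_indicator hT0.le hv hk hE hEa hg] with x hx hxF
      have h1 : ENNReal.ofReal (T * δ) ≤ ‖g x‖ₑ := by
        rw [← ofReal_norm]
        exact ENNReal.ofReal_le_ofReal (hx (hFa hxF))
      have h2 : 1 ≤ ENNReal.ofReal (T * δ) := ENNReal.one_le_ofReal.2 hTδ
      calc ENNReal.ofReal (T * δ) ^ β ≤ ENNReal.ofReal (T * δ) ^ p x :=
            ENNReal.rpow_le_rpow_of_exponent_le h2 (hβ x hxF)
        _ ≤ ‖g x‖ₑ ^ p x := ENNReal.rpow_le_rpow h1 (by linarith [hp1 x])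
    have hfin : ENNReal.ofReal (T * δ) ^ β * volume F ≤ C * (ENNReal.ofReal T ^ α * volume E) :=
      hlow.trans ((hC _ hf g hg).trans (by gcongr))
    rw [ENNReal.ofReal_rpow_of_pos (by positivity), ENNReal.ofReal_rpow_of_pos hT0] at hfin
    have hreal := ENNReal.toReal_mono (by finiteness) hfin
    simp only [ENNReal.toReal_mul, ENNReal.coe_toReal] at hreal
    rw [ENNReal.toReal_ofReal (by positivity), ENNReal.toReal_ofReal (by positivity),
      Real.mul_rpow hT0.le hδ.le] at hreal
    change T ^ β * δ ^ β * volume.real F ≤ C * (T ^ α * volume.real E) at hreal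
    rw [le_div_iff₀ (by positivity), Real.rpow_sub hT0, div_mul_eq_mul_div,
      div_le_iff₀ (by positivity)]
    linarith
  obtain ⟨T, hT, hT1, hT2⟩ := (((tendsto_rpow_atTop (sub_pos.2 hαβ)).eventually
    (eventually_gt_atTop (C * volume.real E / (δ ^ β * volume.real F)))).and
    ((eventually_ge_atTop 1).and (eventually_ge_atTop (1 / δ)))).exists
  exact absurd (key T hT1 ((div_le_iff₀ hδ).1 hT2)) (not_le.2 hT)

/-- The modular inequality excludes that `p` oscillates in a ball. -/
theorem KernelData.measure_inter_closedBall_eq_zero {K : 𝓢'(Rn n, ℂ)} {k m : Rn n → ℂ} {A c : ℝ≥0}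
    (h : KernelData K k m A c) (hnd : Nondegenerate k) {p : Rn n → ℝ} (hp : Measurable p)
    (hp1 : ∀ x, 1 ≤ p x)
    (hex : ∀ f : Rn n → ℂ, MemVarLp p f → ∃ g, IsConvolution K f g) {C : ℝ≥0}
    (hC : ∀ f : Rn n → ℂ, MemVarLp p f → ∀ g : Rn n → ℂ, IsConvolution K f g →
      modular p g ≤ C * modular p f)
    {ρ : ℝ} (hρ : 0 < ρ) {α β : ℝ} (hαβ : α < β)
    (hα : volume (closedBall (0 : Rn n) ρ ∩ {x | p x ≤ α}) ≠ 0) :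
    volume (closedBall (0 : Rn n) ρ ∩ {x | β ≤ p x}) = 0 := by
  obtain ⟨u, hu, c', hc', hlow⟩ := hnd
  obtain ⟨γ, hαγ, hγβ⟩ := exists_between hαβ
  have hc0 : (0 : ℝ) ≤ c := c.2
  set t : ℝ := (5 + 4 * c / c') * ρ with ht
  have ht5 : 5 * ρ ≤ t := by
    have : 0 ≤ 4 * c / c' * ρ := by positivity
    linarith [add_mul (5 : ℝ) (4 * c / c') ρ]
  have ht0 : 0 < t := by linarith
  have hle : ∀ γ : ℝ, MeasurableSet {x | p x ≤ γ} := fun γ => measurableSet_le hp measurable_const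
  have hge : ∀ γ : ℝ, MeasurableSet {x | γ ≤ p x} := fun γ => measurableSet_le measurable_const hp
  have main : ∀ s : ℝ, |s| = t → ∀ (a : Rn n) (α β : ℝ), α < β →
      volume (closedBall a ρ ∩ {x | p x ≤ α}) ≠ 0 →
      volume (closedBall (a + s • u) ρ ∩ {x | β ≤ p x}) = 0 := by
    intro s hs a α β hαβ hα
    have hs0 : s ≠ 0 := abs_pos.1 (hs ▸ ht0)
    have hn : ‖s • u‖ = t := by rw [norm_smul, hu, mul_one, Real.norm_eq_abs, hs]
    have hpos : 0 < ‖k (s • u)‖ :=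
      lt_of_lt_of_le (by rw [hn]; positivity) (hlow s hs0)
    exact h.measure_eq_zero_of_modular_le hp1 hex hC (by rw [hn]; linarith) hpos
      (fun z hz => h.norm_kernel_sub_le_half hu hc' hlow hρ hs.ge hz)
      (isClosed_closedBall.measurableSet.inter (hle α))
      (isClosed_closedBall.measurableSet.inter (hge β)) inter_subset_left inter_subset_left hαβ
      (fun x hx => hx.2) (fun x hx => hx.2) hα
  have htabs : |t| = t := abs_of_pos ht0
  have h1 := main t htabs 0 α γ hαγ hα
  have h2 : volume (closedBall (0 + t • u) ρ ∩ {x | p x ≤ γ}) ≠ 0 := by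
    intro h0
    have h3 : volume (closedBall (0 + t • u) ρ) ≤ 0 := by
      calc volume (closedBall (0 + t • u) ρ)
          ≤ volume (closedBall (0 + t • u) ρ ∩ {x | p x ≤ γ} ∪
              closedBall (0 + t • u) ρ ∩ {x | γ ≤ p x}) := by
            refine measure_mono fun x hx => ?_
            rcases le_total (p x) γ with hxγ | hxγ
            · exact Or.inl ⟨hx, hxγ⟩
            · exact Or.inr ⟨hx, hxγ⟩
        _ ≤ 0 := (measure_union_le _ _).trans (by rw [h0, h1, add_zero])
    exact absurd h3 (not_le.2 (measure_closedBall_pos volume _ hρ))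
  have h4 := main (-t) (by rw [abs_neg, htabs]) (0 + t • u) γ β hγβ h2
  rwa [neg_smul, add_neg_cancel_right] at h4

theorem ae_eq_const_of_measure_eq_zero {p : Rn n → ℝ}
    (H : ∀ (ρ α β : ℝ), 0 < ρ → α < β → volume (closedBall (0 : Rn n) ρ ∩ {x | p x ≤ α}) ≠ 0 →
      volume (closedBall (0 : Rn n) ρ ∩ {x | β ≤ p x}) = 0) :
    ∃ q : ℝ, ∀ᵐ x ∂(volume : Measure (Rn n)), p x = q := by
  have hball : ∀ S : Set (Rn n), volume S ≠ 0 →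
      ∃ N : ℕ, ∀ M : ℕ, N ≤ M → volume (closedBall (0 : Rn n) M ∩ S) ≠ 0 := by
    intro S hS
    by_contra! hcon
    refine hS ?_
    have : S ⊆ ⋃ N : ℕ, closedBall (0 : Rn n) N ∩ S := by
      intro x hx
      obtain ⟨N, hN⟩ := exists_nat_ge (dist x 0)
      exact mem_iUnion.2 ⟨N, hN, hx⟩
    refine measure_mono_null this (measure_iUnion_null fun N => ?_)
    obtain ⟨M, hNM, hM⟩ := hcon N
    refine measure_mono_null (inter_subset_inter_left _ (closedBall_subset_closedBall ?_)) hM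
    exact_mod_cast hNM
  have hglob : ∀ α β : ℝ, α < β → volume {x | p x ≤ α} ≠ 0 → volume {x | β ≤ p x} = 0 := by
    intro α β hαβ h1
    by_contra h2
    obtain ⟨N, hN⟩ := hball _ h1
    obtain ⟨N', hN'⟩ := hball _ h2
    refine hN' (N + N' + 1) (by omega)
      (H _ α β (by positivity) hαβ (hN (N + N' + 1) (by omega)))
  have hsep : HasCountableSeparatingOn ℝ (fun U => ∃ b, U = Iio b) univ := by
    refine ⟨⟨range fun r : ℚ => Iio (r : ℝ), countable_range _, ?_, fun x _ y _ hxy => ?_⟩⟩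
    · rintro _ ⟨r, rfl⟩
      exact ⟨_, rfl⟩
    · by_contra hne
      rcases lt_or_gt_of_ne hne with hlt | hlt
      · obtain ⟨r, h1, h2⟩ := exists_rat_btwn hlt
        exact absurd ((hxy _ ⟨r, rfl⟩).1 h1) (not_lt.2 h2.le)
      · obtain ⟨r, h1, h2⟩ := exists_rat_btwn hlt
        exact absurd ((hxy _ ⟨r, rfl⟩).2 h1) (not_lt.2 h2.le)
  refine exists_eventuallyEq_const_of_forall_separating (fun U => ∃ b, U = Iio b) ?_
  rintro _ ⟨b, rfl⟩
  by_cases hb : ∃ a < b, volume {x | p x ≤ a} ≠ 0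
  · obtain ⟨a, hab, ha⟩ := hb
    left
    rw [ae_iff]
    simpa using hglob a b hab ha
  · push Not at hb
    right
    rw [ae_iff]
    have : {x | ¬ p x ∉ Iio b} ⊆ ⋃ r : ℚ, {x | (r : ℝ) < b ∧ p x ≤ r} := by
      intro x hx
      obtain ⟨r, h1, h2⟩ := exists_rat_btwn (not_not.1 hx : p x < b)
      exact mem_iUnion.2 ⟨r, h2, h1.le⟩
    refine measure_mono_null this (measure_iUnion_null fun r => ?_)
    by_cases hr : (r : ℝ) < b
    · simpa [hr] using hb r hr
    · simp [hr]

theorem Nondegenerate.ne_zero {k : Rn n → ℂ} (hk : Nondegenerate k) : n ≠ 0 := by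
  rintro rfl
  obtain ⟨u, hu, -⟩ := hk
  simp [Subsingleton.elim u 0] at hu

end VarLp

theorem theorem2 (n : ℕ)
    (K : 𝓢'(VarLp.Rn n, ℂ)) (k : VarLp.Rn n → ℂ)
    (hK : VarLp.IsCZKernel K k) (hk : VarLp.Nondegenerate k)
    (p : VarLp.Rn n → ℝ) (hp : Measurable p) (hp1 : ∀ x, 1 ≤ p x)
    (hpm : 1 < VarLp.pMinus p) (hpp : VarLp.pPlus p < ∞) :
    -- `Tf = f * K` is a well-defined function (up to null sets) for each `f ∈ L^{p(·)}`
    (∀ f : VarLp.Rn n → ℂ, VarLp.MemVarLp p f →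
      ∃ g : VarLp.Rn n → ℂ, VarLp.IsConvolution K f g ∧
        ∀ g' : VarLp.Rn n → ℂ, VarLp.IsConvolution K f g' → g' =ᵐ[volume] g) ∧
    -- the modular inequality holds if and only if `p` is a.e. constant
    ((∃ C : ℝ≥0, ∀ f : VarLp.Rn n → ℂ, VarLp.MemVarLp p f →
        ∀ g : VarLp.Rn n → ℂ, VarLp.IsConvolution K f g →
          VarLp.modular p g ≤ C * VarLp.modular p f) ↔
      ∃ q : ℝ, ∀ᵐ x ∂(volume : Measure (VarLp.Rn n)), p x = q) := by
  obtain ⟨m, A, c, h⟩ := hK.exists_kernelData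
  have hn := hk.ne_zero
  have hex : ∀ f : VarLp.Rn n → ℂ, VarLp.MemVarLp p f → ∃ g, VarLp.IsConvolution K f g :=
    fun f hf => h.exists_isConvolution_of_memVarLp hn hpm hpp hf
  refine ⟨fun f hf => ?_, ?_, ?_⟩
  · obtain ⟨g, hg⟩ := hex f hf
    exact ⟨g, hg, fun g' hg' => hg'.unique hg⟩
  · rintro ⟨C, hC⟩
    exact VarLp.ae_eq_const_of_measure_eq_zero fun ρ α β hρ hαβ hα =>
      h.measure_inter_closedBall_eq_zero hk hp hp1 hex hC hρ hαβ hα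
  · rintro ⟨q, hq⟩
    exact h.exists_modular_le_of_ae_const hn hpm hq
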